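/- For $z$ in the upper half-plane $\mathbb{H}$ put $q=e^{2\pi i z}$ and $f'=\frac1{2\pi i}\frac{df}{dz}$. Let $E_2=1-24\sum_{n\ge1}\sigma_1(n)q^n$, $E_4=1+240\sum_{n\ge1}\sigma_3(n)q^n$, $E_6=1-504\sum_{n\ge1}\sigma_5(n)q^n$ and $\Delta=\frac1{1728}(E_4^3-E_6^2)$. Consider the sequence $(f_w)$ ($w\equiv2\pmod 4$, $w\ge10$) of functions on $\mathbb{H}$ given by the initial elements $$f_{10}=-E_4E_6+2E_2E_4^2-E_2^2E_6,$$ $$f_{14}=-\tfrac1{8400}\left(E_4^2E_6-E_2(E_4^3+E_6^2)+E_2^2E_4E_6\right),$$ $$f_{18}=-\tfrac1{1995840000}\left(5E_4^3E_6+7E_6^3-E_2(5E_4^4+19E_4E_6^2)+12E_2^2E_4^2E_6\right)$$ and, for $w\ge18$, $w\equiv2\pmod4$, by the recurrence $$f_{w+4}=\frac{200(w-9)(w-10)(w^2-21w+92)E_4f_w-\frac58(w-10)(w-14)E_4^2f_{w-4}+\Delta f_{w-8}}{16000(w-3)(w-4)(w-5)(w-9)(w-11)(w-16)}.$$ Then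 $$f_{10}=-\tfrac{24}7E_6'',\qquad f_{14}=-\tfrac3{19250}(E_4E_6)''-\tfrac{36}{875}E_2\Delta,\qquad f_{18}=-\tfrac1{242550000}(E_4^2E_6)''+\tfrac{\Delta(181E_6-185E_2E_4)}{40425000},$$ and for every $w\equiv2\pmod4$, $w\ge10$, the following hold. (1) $f=f_w$ satisfies the differential equation $$\begin{aligned}&E_6f'''-\left(\tfrac{w-2}4E_4^2+\tfrac w2E_6'\right)f''+\left(\tfrac{w-6}4E_4E_6+\tfrac{(w-1)(w-2)}8E_4E_4'+\tfrac{w(w-1)}{14}E_6''\right)f'\\&-\left(\tfrac{(w-2)(w-6)}{24}E_4E_6'+\tfrac{5(w-8)(w-9)(w-10)}{384}(E_4')^2+\tfrac{w^3+105w^2-1162w+3576}{480}E_4E_4''+\tfrac{w(w-1)(w-2)}{336}E_6'''\right)f=0.\end{aligned}$$ (2) There are unique holomorphic modular forms $A_w$, $B_w$, $C_w$ for $\mathrm{SL}(2,\mathbb{Z})$ of respective weights $w$, $w-2$, $w-4$ such that $f_w=A_w-2E_2B_w+E_2^2C_w$; thus $f_w$ is a quasimodular form of weight $w$. (3) Put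 $g_w=B_w-E_2C_w$ and $h_w=C_w$. The exact orders of $f_w$, $g_w$ and $h_w$ for $q\to0$ are $q^{(w-6)/4}$, $q$ and $1$; that is, $f_w/q^{(w-6)/4}$, $g_w/q$ and $h_w$ have finite non-zero limits as $\operatorname{Im}z\to\infty$. -/

import Mathlib

open UpperHalfPlane ModularForm EisensteinSeries Derivative
open scoped MatrixGroups Topology

noncomputable section

namespace QuasimodularRecurrence

/-- `F` has exact order `q ^ m` for `q → 0` (that is, `Im z → ∞`), where `q = exp (2 π i z)`:
the quotient `F / q ^ m` has a finite non-zero limit. -/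
def HasExactOrder (F : ℍ → ℂ) (m : ℕ) : Prop :=
  ∃ c : ℂ, c ≠ 0 ∧
    Filter.Tendsto (fun z : ℍ => F z / Function.Periodic.qParam 1 (z : ℂ) ^ m) atImInfty (𝓝 c)

/-- `F = A - 2 E₂ B + E₂² C` with holomorphic modular forms `A`, `B`, `C` for `SL(2, ℤ)` of weights
`w`, `w - 2`, `w - 4`: a quasimodular form of weight `w` and depth at most `2`. -/
def IsDecomposition (w : ℤ) (F : ℍ → ℂ) (A : ModularForm 𝒮ℒ w) (B : ModularForm 𝒮ℒ (w - 2))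
    (C : ModularForm 𝒮ℒ (w - 4)) : Prop :=
  ∀ z : ℍ, F z = A z - 2 * E2 z * B z + E2 z ^ 2 * C z

/-- The third order linear differential equation with leading coefficient `E₆` and parameter `w`;
`D` is the derivation `(2 π i)⁻¹ d/dz`. -/
def SolvesODE (w : ℂ) (F : ℍ → ℂ) : Prop :=
  ∀ z : ℍ,
    E₆ z * (D^[3] F) z
      - ((w - 2) / 4 * E₄ z ^ 2 + w / 2 * (D E₆) z) * (D^[2] F) z
      + ((w - 6) / 4 * (E₄ z * E₆ z) + (w - 1) * (w - 2) / 8 * (E₄ z * (D E₄) z)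
          + w * (w - 1) / 14 * (D^[2] E₆) z) * (D F) z
      - ((w - 2) * (w - 6) / 24 * (E₄ z * (D E₆) z)
          + 5 * (w - 8) * (w - 9) * (w - 10) / 384 * (D E₄) z ^ 2
          + (w ^ 3 + 105 * w ^ 2 - 1162 * w + 3576) / 480 * (E₄ z * (D^[2] E₄) z)
          + w * (w - 1) * (w - 2) / 336 * (D^[3] E₆) z) * F z = 0

/-- The sequence `f w` (only the indices `w ≡ 2 (mod 4)`, `w ≥ 10` matter): three initial elements
of weights `10`, `14`, `18`, and a three-term recurrence which gives `f (w + 4)` for `w ≥ 18`. -/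
structure IsRecurrenceSequence (f : ℕ → ℍ → ℂ) : Prop where
  init_ten : ∀ z : ℍ,
    f 10 z = -(E₄ z * E₆ z) + 2 * E2 z * E₄ z ^ 2 - E2 z ^ 2 * E₆ z
  init_fourteen : ∀ z : ℍ,
    f 14 z = -(1 / 8400) * (E₄ z ^ 2 * E₆ z - E2 z * (E₄ z ^ 3 + E₆ z ^ 2)
      + E2 z ^ 2 * E₄ z * E₆ z)
  init_eighteen : ∀ z : ℍ,
    f 18 z = -(1 / 1995840000) * (5 * E₄ z ^ 3 * E₆ z + 7 * E₆ z ^ 3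
      - E2 z * (5 * E₄ z ^ 4 + 19 * E₄ z * E₆ z ^ 2) + 12 * E2 z ^ 2 * E₄ z ^ 2 * E₆ z)
  recurrence : ∀ w : ℕ, 18 ≤ w → w % 4 = 2 → ∀ z : ℍ,
    f (w + 4) z =
      1 / (16000 * ((w : ℂ) - 3) * (w - 4) * (w - 5) * (w - 9) * (w - 11) * (w - 16)) *
        (200 * ((w : ℂ) - 9) * (w - 10) * (w ^ 2 - 21 * w + 92) * E₄ z * f w z
          - 5 / 8 * ((w : ℂ) - 10) * (w - 14) * E₄ z ^ 2 * f (w - 4) z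
          + discriminant z * f (w - 8) z)

end QuasimodularRecurrence

end

/-!
Write `∂` for the Serre derivative `D - k / 12 * E₂` with `k = w - 2` on `f_w` (as befits depth
`2`) and `k = w` on `∂ f_w`. The three-term recurrence propagates two contiguity relations, one
expressing `E₆ ∂ f_w` through `f_w`, `f_{w+4}`, `f_{w+8}` and one of the form
`∂² f_w = (w - 8) (w - 9) / 36 * E₄ f_w + c_w f_{w+4}` with an explicit `c_w ≠ 0`. Both hold for the
initial elements by Ramanujan's identities. Applying `∂` to the second relation and eliminating the
neighbours of `f_w` leaves the differential equation.

Read as a formula for `f_{w+4}`, the second relation is an operator on depth `2` quasimodular forms,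
so the decomposition is built inductively together with the leading coefficients of `g_w` and `h_w`.
On `q ^ n` the operator `∂²` acts to leading order by `(n - (w - 2) / 12) * (n - w / 12)`, which
equals `(w - 8) (w - 9) / 36` at `n = (w - 6) / 4`: hence the order of `f_w` at the cusp grows by at
least one at each step. That it grows by exactly one follows by comparing coefficients of
`q ^ ((w - 10) / 4)` in the recurrence, where only `E₄² f_{w-4}` and `Δ f_{w-8}` contribute.

Uniqueness of the decomposition follows from the transformation of `E₂` under `S` and `S * T`.
-/

open Function.Periodic (qParam qParam_ne_zero)
open scoped Manifold

namespace QuasimodularRecurrence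

/-! ### Leading terms at the cusp -/

/-- Near `i∞` the function `F` is `q ^ n * G q` with `q = exp (2 π i z)`, where `G` is analytic at
`0` and `G 0 = c`. The value `c = 0` is allowed, so `n` is only a lower bound for the order of
vanishing. -/
def HasLeadingTerm (F : ℍ → ℂ) (n : ℕ) (c : ℂ) : Prop :=
  ∃ G : ℂ → ℂ, AnalyticAt ℂ G 0 ∧ G 0 = c ∧
    ∀ᶠ z : ℍ in atImInfty, F z = qParam 1 z ^ n * G (qParam 1 z)

lemma hasDerivAt_qParam_one (z : ℂ) :
    HasDerivAt (qParam 1) (2 * Real.pi * Complex.I * qParam 1 z) z := by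
  have h : HasDerivAt (fun w : ℂ => 2 * Real.pi * Complex.I * w / ((1 : ℝ) : ℂ))
      (2 * Real.pi * Complex.I) z := by
    simpa using (hasDerivAt_id z).const_mul (2 * Real.pi * Complex.I)
  rw [mul_comm]
  exact h.cexp

lemma analyticAt_zero_tsum_mul_pow {c : ℕ → ℂ} {q : ℂ} (hq : q ≠ 0)
    (h : Summable fun m => c m * q ^ m) : AnalyticAt ℂ (fun x => ∑' m, c m * x ^ m) 0 := by
  let p := FormalMultilinearSeries.ofScalars ℂ c
  have hradius : (0 : ENNReal) < p.radius := by
    refine lt_of_lt_of_le (by simpa using hq) (p.le_radius_of_tendsto (r := ‖q‖₊) (l := 0) ?_)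
    simpa [p, norm_mul, norm_pow] using h.tendsto_atTop_zero.norm
  have hsum : p.sum = fun x => ∑' m, c m * x ^ m := by
    ext x
    simp [p, FormalMultilinearSeries.sum, mul_comm]
  exact hsum ▸ (p.hasFPowerSeriesOnBall hradius).analyticAt

lemma eventually_eventuallyEq_comp_ofComplex {F : ℍ → ℂ} {g : ℂ → ℂ}
    (h : ∀ᶠ z : ℍ in atImInfty, F z = g z) :
    ∀ᶠ z : ℍ in atImInfty, F ∘ ofComplex =ᶠ[𝓝 (z : ℂ)] g := by
  obtain ⟨A, hA⟩ := (atImInfty_mem _).mp h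
  refine (atImInfty_mem _).mpr ⟨A + 1, fun z hz => ?_⟩
  have him {a : ℝ} (ha : a < z.im) : ∀ᶠ w : ℂ in 𝓝 (z : ℂ), a < w.im :=
    (isOpen_lt continuous_const Complex.continuous_im).mem_nhds ha
  filter_upwards [him z.im_pos, him (show A < z.im by linarith)] with w hw hAw
  simpa [ofComplex_apply_of_im_pos hw] using hA ⟨w, hw⟩ hAw.le

namespace HasLeadingTerm

variable {F F₁ F₂ : ℍ → ℂ} {n m : ℕ} {c c₁ c₂ : ℂ}

lemma congr (h : HasLeadingTerm F₁ n c₁) (hF : ∀ z, F₂ z = F₁ z) (hc : c₂ = c₁) :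
    HasLeadingTerm F₂ n c₂ := by
  obtain rfl : F₂ = F₁ := funext hF
  exact hc ▸ h

lemma const (c : ℂ) : HasLeadingTerm (fun _ => c) 0 c :=
  ⟨fun _ => c, analyticAt_const, rfl, by simp⟩

lemma of_hasSum {c : ℕ → ℂ} (h : ∀ z : ℍ, HasSum (fun m => c m * qParam 1 z ^ (n + m)) (F z)) :
    HasLeadingTerm F n (c 0) := by
  have hsummable (z : ℍ) : Summable fun m => c m * qParam 1 z ^ m := by
    refine ((h z).summable.mul_left (qParam 1 z ^ n)⁻¹).congr fun m => ?_
    have := qParam_ne_zero (h := 1) (z : ℂ)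
    field_simp
    ring
  refine ⟨fun q => ∑' m, c m * q ^ m,
    analyticAt_zero_tsum_mul_pow (qParam_ne_zero _) (hsummable I), ?_, .of_forall fun z => ?_⟩
  · exact (tsum_eq_single 0 fun m hm => by simp [hm]).trans (by simp)
  · rw [← (h z).tsum_eq, ← tsum_mul_left]
    exact tsum_congr fun m => by ring

lemma add (h₁ : HasLeadingTerm F₁ n c₁) (h₂ : HasLeadingTerm F₂ n c₂) :
    HasLeadingTerm (fun z => F₁ z + F₂ z) n (c₁ + c₂) := by
  obtain ⟨G₁, ha₁, rfl, he₁⟩ := h₁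
  obtain ⟨G₂, ha₂, rfl, he₂⟩ := h₂
  refine ⟨fun q => G₁ q + G₂ q, ha₁.add ha₂, rfl, ?_⟩
  filter_upwards [he₁, he₂] with z h₁ h₂
  rw [h₁, h₂, mul_add]

lemma mul (h₁ : HasLeadingTerm F₁ n c₁) (h₂ : HasLeadingTerm F₂ m c₂) :
    HasLeadingTerm (fun z => F₁ z * F₂ z) (n + m) (c₁ * c₂) := by
  obtain ⟨G₁, ha₁, rfl, he₁⟩ := h₁
  obtain ⟨G₂, ha₂, rfl, he₂⟩ := h₂
  refine ⟨fun q => G₁ q * G₂ q, ha₁.mul ha₂, rfl, ?_⟩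
  filter_upwards [he₁, he₂] with z h₁ h₂
  rw [h₁, h₂]
  ring

lemma const_mul (a : ℂ) (h : HasLeadingTerm F n c) :
    HasLeadingTerm (fun z => a * F z) n (a * c) := by
  simpa using (const a).mul h

lemma sub (h₁ : HasLeadingTerm F₁ n c₁) (h₂ : HasLeadingTerm F₂ n c₂) :
    HasLeadingTerm (fun z => F₁ z - F₂ z) n (c₁ - c₂) :=
  (h₁.add (h₂.const_mul (-1))).congr (fun z => by ring) (by ring)

lemma mul_of_zero_exponent (h₁ : HasLeadingTerm F₁ 0 c₁) (h₂ : HasLeadingTerm F₂ n c₂) :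
    HasLeadingTerm (fun z => F₁ z * F₂ z) n (c₁ * c₂) := by
  simpa using h₁.mul h₂

lemma zero_of_lt (h : HasLeadingTerm F n c) (hmn : m < n) : HasLeadingTerm F m 0 := by
  obtain ⟨d, rfl⟩ := Nat.exists_eq_add_of_lt hmn
  obtain ⟨G, ha, -, he⟩ := h
  refine ⟨fun q => q ^ (d + 1) * G q, (analyticAt_id.pow (d + 1)).mul ha, by simp, ?_⟩
  filter_upwards [he] with z h
  rw [h]
  ring

lemma exists_succ (h : HasLeadingTerm F n 0) : ∃ c, HasLeadingTerm F (n + 1) c := by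
  obtain ⟨G, ⟨p, hp⟩, h0, he⟩ := h
  refine ⟨_, dslope G 0, ⟨_, hp.has_fpower_series_dslope_fslope⟩, rfl, ?_⟩
  filter_upwards [he] with z h
  have hslope := sub_smul_dslope G 0 (qParam 1 z)
  rw [sub_zero, h0, sub_zero, smul_eq_mul] at hslope
  rw [h, ← hslope]
  ring

lemma tendsto (h : HasLeadingTerm F n c) :
    Filter.Tendsto (fun z : ℍ => F z / qParam 1 z ^ n) atImInfty (𝓝 c) := by
  obtain ⟨G, ha, rfl, he⟩ := h
  refine (ha.continuousAt.tendsto.comp (qParam_tendsto_atImInfty one_pos)).congr' ?_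
  filter_upwards [he] with z h
  rw [h, Function.comp_apply, mul_div_cancel_left₀ _ (pow_ne_zero n (qParam_ne_zero _))]

lemma unique (h₁ : HasLeadingTerm F n c₁) (h₂ : HasLeadingTerm F n c₂) : c₁ = c₂ :=
  tendsto_nhds_unique h₁.tendsto h₂.tendsto

lemma hasExactOrder (h : HasLeadingTerm F n c) (hc : c ≠ 0) : HasExactOrder F n :=
  ⟨c, hc, h.tendsto⟩

lemma isBoundedAtImInfty (h : HasLeadingTerm F 0 c) : IsBoundedAtImInfty F :=
  Filter.Tendsto.isBigO_one ℝ (by simpa using h.tendsto)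

lemma normalizedDeriv (h : HasLeadingTerm F n c) : HasLeadingTerm (D F) n (n * c) := by
  obtain ⟨G, ha, rfl, he⟩ := h
  refine ⟨fun q => n * G q + q * deriv G q,
    (analyticAt_const.mul ha).add (analyticAt_id.mul ha.deriv), by simp, ?_⟩
  filter_upwards [(qParam_tendsto_atImInfty one_pos).eventually ha.eventually_analyticAt,
    eventually_eventuallyEq_comp_ofComplex (g := fun z => qParam 1 z ^ n * G (qParam 1 z)) he]
    with z hG hF
  have hq := hasDerivAt_qParam_one z
  have hderiv := ((hq.pow n).mul (hG.differentiableAt.hasDerivAt.comp (z : ℂ) hq)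
    ).congr_of_eventuallyEq hF
  rw [normalizedDerivOfComplex, hderiv.deriv]
  simp only [Function.comp_apply, Pi.pow_apply]
  have := Complex.two_pi_I_ne_zero
  rcases n with _ | n
  · field_simp
    ring
  · simp only [Nat.add_sub_cancel]
    field_simp
    ring

end HasLeadingTerm

lemma hasLeadingTerm_zero_of_qExpansion {k : ℤ} {𝓕 : Type*} [FunLike 𝓕 ℍ ℂ]
    [ModularFormClass 𝓕 𝒮ℒ k] (M : 𝓕) : HasLeadingTerm M 0 ((qExpansion 1 M).coeff 0) :=
  .of_hasSum (c := fun m => (qExpansion 1 M).coeff m) fun z => by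
    simpa only [zero_add] using ModularForm.hasSum_qExpansion M one_pos one_mem_strictPeriods_SL z

lemma hasLeadingTerm_one_of_qExpansion {k : ℤ} {𝓕 : Type*} [FunLike 𝓕 ℍ ℂ]
    [ModularFormClass 𝓕 𝒮ℒ k] (M : 𝓕) :
    HasLeadingTerm (fun z => M z - (qExpansion 1 M).coeff 0) 1 ((qExpansion 1 M).coeff 1) :=
  .of_hasSum (c := fun m => (qExpansion 1 M).coeff (m + 1)) fun z => by
    simpa [add_comm] using (hasSum_nat_add_iff' 1).mpr
      (ModularForm.hasSum_qExpansion M one_pos one_mem_strictPeriods_SL z)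

lemma hasLeadingTerm_E₄ : HasLeadingTerm E₄ 0 1 :=
  (hasLeadingTerm_zero_of_qExpansion E₄).congr (fun _ => rfl)
    (E_qExpansion_coeff_zero _ ⟨2, rfl⟩).symm

lemma hasLeadingTerm_E₆ : HasLeadingTerm E₆ 0 1 :=
  (hasLeadingTerm_zero_of_qExpansion E₆).congr (fun _ => rfl)
    (E_qExpansion_coeff_zero _ ⟨3, rfl⟩).symm

lemma hasLeadingTerm_E2 : HasLeadingTerm E2 0 1 := by
  refine .of_hasSum (c := fun m => if m = 0 then 1 else -24 * ArithmeticFunction.sigma 1 m)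
    fun z => ?_
  simpa [qParam] using hasSum_qExpansion_E2 z

lemma hasLeadingTerm_discriminant : HasLeadingTerm discriminant 1 1 := by
  have h0 : (qExpansion 1 CuspForm.discriminant).coeff 0 = 0 :=
    CuspFormClass.qExpansion_coeff_zero _ one_pos one_mem_strictPeriods_SL
  exact (hasLeadingTerm_one_of_qExpansion CuspForm.discriminant).congr
    (fun z => by rw [h0, sub_zero, CuspForm.coe_discriminant])
    discriminant_qExpansion_coeff_one.symm

lemma hasLeadingTerm_normalizedDeriv_E₆ : HasLeadingTerm (D E₆) 1 (-504) := by
  have hconst : D (fun z : ℍ => E₆ z - (qExpansion 1 E₆).coeff 0) = D E₆ := by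
    have h := normalizedDerivOfComplex_sub E₆ (fun _ => (qExpansion 1 E₆).coeff 0)
      (ModularFormClass.holo E₆) mdifferentiable_const
    rwa [normalizedDerivOfComplex_const, sub_zero] at h
  have h := (hasLeadingTerm_one_of_qExpansion E₆).normalizedDeriv
  rw [hconst, E₆_qExpansion_coeff_one] at h
  simpa using h

lemma HasLeadingTerm.serreDerivative {F : ℍ → ℂ} {n : ℕ} {c : ℂ} (k : ℂ)
    (h : HasLeadingTerm F n c) :
    HasLeadingTerm (serreDerivative k F) n ((n - k / 12) * c) :=
  (h.normalizedDeriv.sub ((hasLeadingTerm_E2.mul_of_zero_exponent h).const_mul (k / 12))).congr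
    (fun z => by rw [serreDerivative_apply]; ring) (by ring)

/-! ### Serre derivatives -/

/-- The function `F` is holomorphic on `ℍ`, and `F'` is its Serre derivative of weight `k`, that
is `D F - k / 12 * E₂ * F`. For `k = 0` this is the derivation `D`. -/
def HasSerreDeriv (k : ℂ) (F F' : ℍ → ℂ) : Prop := MDiff F ∧ serreDerivative k F = F'

namespace HasSerreDeriv

variable {k l : ℂ} {F F' F₁ F₁' F₂ F₂' : ℍ → ℂ}

lemma of_mdifferentiable (k : ℂ) (h : MDiff F) : HasSerreDeriv k F (serreDerivative k F) :=
  ⟨h, rfl⟩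

lemma congr (h : HasSerreDeriv k F₁ F₁') (hF : ∀ z, F₂ z = F₁ z) (hF' : ∀ z, F₂' z = F₁' z)
    (hk : l = k) : HasSerreDeriv l F₂ F₂' := by
  obtain rfl : F₂ = F₁ := funext hF
  obtain rfl : F₂' = F₁' := funext hF'
  exact hk ▸ h

lemma mdifferentiable_deriv (h : HasSerreDeriv k F F') : MDiff F' :=
  h.2 ▸ serreDerivative_mdifferentiable k h.1

lemma normalizedDeriv (h : HasSerreDeriv k F F') (z : ℍ) :
    D F z = F' z + k / 12 * E2 z * F z := by
  have hz := congrFun h.2 z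
  rw [serreDerivative_apply] at hz
  linear_combination hz

lemma changeWeight (h : HasSerreDeriv k F F') (l : ℂ) :
    HasSerreDeriv l F (fun z => F' z + (k - l) / 12 * E2 z * F z) :=
  ⟨h.1, funext fun z => by rw [serreDerivative_apply, h.normalizedDeriv]; ring⟩

lemma const_mul (a : ℂ) (h : HasSerreDeriv k F F') :
    HasSerreDeriv k (fun z => a * F z) (fun z => a * F' z) := by
  obtain ⟨h, rfl⟩ := h
  exact ⟨h.const_smul a, serreDerivative_smul k a F h⟩

lemma add (h₁ : HasSerreDeriv k F₁ F₁') (h₂ : HasSerreDeriv k F₂ F₂') :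
    HasSerreDeriv k (fun z => F₁ z + F₂ z) (fun z => F₁' z + F₂' z) := by
  obtain ⟨h₁, rfl⟩ := h₁
  obtain ⟨h₂, rfl⟩ := h₂
  exact ⟨h₁.add h₂, serreDerivative_add k F₁ F₂ h₁ h₂⟩

lemma sub (h₁ : HasSerreDeriv k F₁ F₁') (h₂ : HasSerreDeriv k F₂ F₂') :
    HasSerreDeriv k (fun z => F₁ z - F₂ z) (fun z => F₁' z - F₂' z) := by
  obtain ⟨h₁, rfl⟩ := h₁
  obtain ⟨h₂, rfl⟩ := h₂
  exact ⟨h₁.sub h₂, serreDerivative_sub k F₁ F₂ h₁ h₂⟩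

lemma mul (h₁ : HasSerreDeriv k F₁ F₁') (h₂ : HasSerreDeriv l F₂ F₂') :
    HasSerreDeriv (k + l) (fun z => F₁ z * F₂ z) (fun z => F₁' z * F₂ z + F₁ z * F₂' z) := by
  obtain ⟨h₁, rfl⟩ := h₁
  obtain ⟨h₂, rfl⟩ := h₂
  exact ⟨h₁.mul h₂, serreDerivative_mul k l F₁ F₂ h₁ h₂⟩

lemma const (a : ℂ) : HasSerreDeriv 0 (fun _ => a) (fun _ => 0) :=
  ⟨mdifferentiable_const, funext fun z => by simp [normalizedDerivOfComplex_const]⟩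

lemma pow (h : HasSerreDeriv k F F') (n : ℕ) :
    HasSerreDeriv (n * k) (fun z => F z ^ n) (fun z => n * F z ^ (n - 1) * F' z) := by
  induction n with
  | zero => exact (const 1).congr (by simp) (by simp) (by simp)
  | succ n ih =>
    refine (ih.mul h).congr (fun z => pow_succ _ _) (fun z => ?_) (by push_cast; ring)
    rcases n with _ | n
    · simp
    · simp only [Nat.add_sub_cancel]
      push_cast
      ring

end HasSerreDeriv

/-! ### Modular forms and Ramanujan's identities -/

/-- `F` underlies a holomorphic modular form of weight `k` for `SL(2, ℤ)`. -/
def IsModular (k : ℤ) (F : ℍ → ℂ) : Prop := ∃ M : ModularForm 𝒮ℒ k, ⇑M = F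

namespace IsModular

variable {k l : ℤ} {F F₁ F₂ : ℍ → ℂ} {c : ℂ}

lemma of_slash_eq (hF : MDiff F) (hs : ∀ γ : SL(2, ℤ), F ∣[k] γ = F)
    (hb : IsBoundedAtImInfty F) : IsModular k F :=
  ⟨{ toFun := F
     slash_action_eq' := fun _ ⟨γ, hγ⟩ => hγ ▸ hs γ
     holo' := hF
     bdd_at_cusps' := fun {c} hc => by
      rw [Subgroup.IsArithmetic.isCusp_iff_isCusp_SL2Z] at hc
      rw [OnePoint.isBoundedAt_iff_forall_SL2Z hc]
      exact fun γ _ => (hs γ).symm ▸ hb }, rfl⟩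

lemma congr (h : IsModular k F₁) (hF : ∀ z, F₂ z = F₁ z) (hk : l = k) : IsModular l F₂ := by
  obtain rfl : F₂ = F₁ := funext hF
  exact hk ▸ h

lemma mul (h₁ : IsModular k F₁) (h₂ : IsModular l F₂) :
    IsModular (k + l) (fun z => F₁ z * F₂ z) := by
  obtain ⟨M₁, rfl⟩ := h₁
  obtain ⟨M₂, rfl⟩ := h₂
  exact ⟨M₁.mul M₂, rfl⟩

lemma add (h₁ : IsModular k F₁) (h₂ : IsModular k F₂) : IsModular k (fun z => F₁ z + F₂ z) := by
  obtain ⟨M₁, rfl⟩ := h₁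
  obtain ⟨M₂, rfl⟩ := h₂
  exact ⟨M₁ + M₂, rfl⟩

lemma const_mul (a : ℂ) (h : IsModular k F) : IsModular k (fun z => a * F z) := by
  obtain ⟨M, rfl⟩ := h
  exact ⟨a • M, rfl⟩

lemma sub (h₁ : IsModular k F₁) (h₂ : IsModular k F₂) : IsModular k (fun z => F₁ z - F₂ z) :=
  (h₁.add (h₂.const_mul (-1))).congr (fun z => by ring) rfl

lemma mdifferentiable (h : IsModular k F) : MDiff F := by
  obtain ⟨M, rfl⟩ := h
  exact ModularFormClass.holo M

lemma slash_eq (h : IsModular k F) (γ : SL(2, ℤ)) : F ∣[k] γ = F := by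
  obtain ⟨M, rfl⟩ := h
  exact SlashInvariantForm.slash_action_eqn M _ ⟨γ, rfl⟩

lemma exists_hasLeadingTerm_zero (h : IsModular k F) : ∃ c, HasLeadingTerm F 0 c := by
  obtain ⟨M, rfl⟩ := h
  exact ⟨_, hasLeadingTerm_zero_of_qExpansion M⟩

lemma serreDerivative (h : IsModular k F) : IsModular (k + 2) (serreDerivative k F) := by
  obtain ⟨c, hc⟩ := h.exists_hasLeadingTerm_zero
  exact .of_slash_eq (serreDerivative_mdifferentiable _ h.mdifferentiable)
    (fun γ => serreDerivative_slash_invariant h.mdifferentiable (h.slash_eq γ))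
    (hc.serreDerivative k).isBoundedAtImInfty

lemma eq_zero_of_weight_lt_twelve (h : IsModular k F) (hk : k < 12)
    (h0 : HasLeadingTerm F 0 0) : F = 0 := by
  obtain ⟨M, rfl⟩ := h
  have hcusp : (qExpansion 1 M).coeff 0 = 0 := (hasLeadingTerm_zero_of_qExpansion M).unique h0
  have hzero := rank_zero_iff_forall_zero.mp (CuspForm.rank_eq_zero_of_weight_lt_twelve hk)
    (toCuspForm M hcusp)
  exact congrArg DFunLike.coe hzero

lemma eq_of_weight_lt_twelve (h₁ : IsModular k F₁) (h₂ : IsModular k F₂) (hk : k < 12)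
    (hc₁ : HasLeadingTerm F₁ 0 c) (hc₂ : HasLeadingTerm F₂ 0 c) : F₁ = F₂ := by
  have h := (h₁.sub h₂).eq_zero_of_weight_lt_twelve hk
    ((hc₁.sub hc₂).congr (fun _ => rfl) (sub_self c).symm)
  exact funext fun z => sub_eq_zero.mp (congrFun h z)

end IsModular

lemma isModular_E₄ : IsModular 4 E₄ := ⟨E₄, rfl⟩

lemma isModular_E₆ : IsModular 6 E₆ := ⟨E₆, rfl⟩

lemma hasSerreDeriv_E₄ : HasSerreDeriv 4 E₄ (fun z => -(1 / 3) * E₆ z) :=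
  ⟨isModular_E₄.mdifferentiable,
    isModular_E₄.serreDerivative.eq_of_weight_lt_twelve (isModular_E₆.const_mul _) (by norm_num)
      (hasLeadingTerm_E₄.serreDerivative 4)
      ((hasLeadingTerm_E₆.const_mul _).congr (fun _ => rfl) (by norm_num))⟩

lemma hasSerreDeriv_E₆ : HasSerreDeriv 6 E₆ (fun z => -(1 / 2) * (E₄ z * E₄ z)) :=
  ⟨isModular_E₆.mdifferentiable,
    isModular_E₆.serreDerivative.eq_of_weight_lt_twelve
      ((isModular_E₄.mul isModular_E₄).const_mul _) (by norm_num)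
      (hasLeadingTerm_E₆.serreDerivative 6)
      (((hasLeadingTerm_E₄.mul hasLeadingTerm_E₄).const_mul _).congr (fun _ => rfl) (by norm_num))⟩

lemma E2_slash_apply (γ : SL(2, ℤ)) (z : ℍ) :
    (E2 ∣[(2 : ℤ)] γ) z =
      E2 z + 12 * (2 * Real.pi * Complex.I)⁻¹ * γ 1 0 * (denom γ z)⁻¹ := by
  rw [E2_slash_action, Pi.sub_apply, Pi.smul_apply, D2, riemannZeta_two, smul_eq_mul]
  have hpi : (Real.pi : ℂ) ≠ 0 := by exact_mod_cast Real.pi_ne_zero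
  have hdenom := denom_ne_zero γ z
  field_simp
  linear_combination (-12 * (γ 1 0 : ℂ)) * Complex.I_sq

lemma normalizedDeriv_inv_denom (γ : SL(2, ℤ)) (z : ℍ) :
    D (fun τ => (denom γ τ)⁻¹) z =
      -((2 * Real.pi * Complex.I)⁻¹ * γ 1 0 * (denom γ z)⁻¹ * (denom γ z)⁻¹) := by
  have hslash : ((fun _ => 1 : ℍ → ℂ) ∣[(1 : ℤ)] γ) = fun τ : ℍ => (denom γ τ)⁻¹ := by
    ext τ
    simp [SL_slash_apply]
  have h := congrFun (normalizedDerivOfComplex_SL_slash (k := 1) (F := fun _ => 1)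
    mdifferentiable_const (γ := γ)) z
  rw [hslash, normalizedDerivOfComplex_const, SlashAction.zero_slash] at h
  simpa [div_eq_mul_inv, mul_assoc] using h

lemma normalizedDeriv_E2_slash (γ : SL(2, ℤ)) (z : ℍ) :
    D (E2 ∣[(2 : ℤ)] γ) z = D E2 z
      - 12 * ((2 * Real.pi * Complex.I)⁻¹ * γ 1 0 * (denom γ z)⁻¹) ^ 2 := by
  have hE : E2 ∣[(2 : ℤ)] γ =
      E2 + (12 * (2 * Real.pi * Complex.I)⁻¹ * γ 1 0) • fun τ : ℍ => (denom γ τ)⁻¹ :=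
    funext fun z => by simpa using E2_slash_apply γ z
  have hdenom : MDiff fun τ : ℍ => (denom γ τ)⁻¹ := mdifferentiable_inv_denom _
  rw [hE, normalizedDerivOfComplex_add _ _ E2_mdifferentiable (hdenom.const_smul _),
    normalizedDerivOfComplex_smul _ _ hdenom, Pi.add_apply, Pi.smul_apply,
    normalizedDeriv_inv_denom, smul_eq_mul]
  ring

/-- Although `E₂` is not modular, its anomaly is exactly compensated in weight `1` (not `2`). -/
lemma serreDerivative_one_E2_slash (γ : SL(2, ℤ)) :
    serreDerivative 1 E2 ∣[(4 : ℤ)] γ = serreDerivative 1 E2 := by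
  ext z
  have hD := congrFun (normalizedDerivOfComplex_SL_slash (k := 2) E2_mdifferentiable (γ := γ)) z
  have hsq := congrFun (mul_slash_SL2 2 2 γ E2 E2) z
  rw [normalizedDeriv_E2_slash, Pi.sub_apply, E2_slash_apply] at hD
  rw [Pi.mul_apply, E2_slash_apply] at hsq
  rw [SL_slash_apply] at hD hsq ⊢
  norm_num at hD hsq ⊢
  linear_combination -hD - hsq / 12

lemma isModular_serreDerivative_one_E2 : IsModular 4 (serreDerivative 1 E2) :=
  .of_slash_eq (serreDerivative_mdifferentiable _ E2_mdifferentiable)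
    serreDerivative_one_E2_slash (hasLeadingTerm_E2.serreDerivative 1).isBoundedAtImInfty

lemma hasSerreDeriv_E2 : HasSerreDeriv 1 E2 (fun z => -(1 / 12) * E₄ z) :=
  ⟨E2_mdifferentiable,
    isModular_serreDerivative_one_E2.eq_of_weight_lt_twelve (isModular_E₄.const_mul _)
      (by norm_num) (hasLeadingTerm_E2.serreDerivative 1)
      ((hasLeadingTerm_E₄.const_mul _).congr (fun _ => rfl) (by norm_num))⟩

lemma discriminant_relation (z : ℍ) : 1728 * discriminant z = E₄ z ^ 3 - E₆ z ^ 2 := by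
  rw [discriminant_eq_E₄_cube_sub_E₆_sq]
  ring

lemma hasSerreDeriv_discriminant : HasSerreDeriv 12 discriminant (fun _ => 0) :=
  ((((hasSerreDeriv_E₄.pow 3).congr (fun _ => rfl) (fun _ => rfl) (by norm_num)).sub
    ((hasSerreDeriv_E₆.pow 2).congr (fun _ => rfl) (fun _ => rfl) (by norm_num))).const_mul
    (1 / 1728)).congr (fun z => by linear_combination (1 / 1728) * discriminant_relation z)
    (fun z => by push_cast; ring) rfl

lemma hasSerreDeriv_monomial (a b c : ℕ) (l : ℂ) :
    HasSerreDeriv l (fun z => E2 z ^ a * E₄ z ^ b * E₆ z ^ c)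
      (fun z => -(a / 12) * (E2 z ^ (a - 1) * E₄ z ^ (b + 1) * E₆ z ^ c)
        - b / 3 * (E2 z ^ a * E₄ z ^ (b - 1) * E₆ z ^ (c + 1))
        - c / 2 * (E2 z ^ a * E₄ z ^ (b + 2) * E₆ z ^ (c - 1))
        + (a + 4 * b + 6 * c - l) / 12 * (E2 z ^ (a + 1) * E₄ z ^ b * E₆ z ^ c)) :=
  ((((hasSerreDeriv_E2.pow a).mul (hasSerreDeriv_E₄.pow b)).mul
    (hasSerreDeriv_E₆.pow c)).changeWeight l).congr (fun _ => rfl) (fun z => by ring) rfl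

namespace HasSerreDeriv

variable {k : ℂ} {F F₁ F₂ F₃ : ℍ → ℂ}

lemma iterate_two_normalizedDeriv (h₁ : HasSerreDeriv k F F₁) (h₂ : HasSerreDeriv (k + 2) F₁ F₂)
    (z : ℍ) : (D^[2] F) z = F₂ z + (k + 1) / 6 * E2 z * F₁ z
      + k / 144 * ((k + 1) * E2 z ^ 2 - E₄ z) * F z := by
  have hD : D F = fun z => F₁ z + k / 12 * (E2 z * F z) :=
    funext fun z => by rw [h₁.normalizedDeriv, mul_assoc]
  have h := (h₂.changeWeight 0).add (((hasSerreDeriv_E2.mul h₁).const_mul (k / 12)).changeWeight 0)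
  simp only [Function.iterate_succ, Function.iterate_zero, Function.comp_apply, id_eq]
  rw [hD, h.normalizedDeriv]
  ring

lemma iterate_three_normalizedDeriv (h₁ : HasSerreDeriv k F F₁)
    (h₂ : HasSerreDeriv (k + 2) F₁ F₂) (h₃ : HasSerreDeriv (k + 4) F₂ F₃) (z : ℍ) :
    (D^[3] F) z = F₃ z + (k + 2) / 4 * E2 z * F₂ z
      + ((k + 1) * (k + 2) / 48 * E2 z ^ 2 - (3 * k + 2) / 144 * E₄ z) * F₁ z
      + k / 144 * ((k + 1) * (k + 2) / 12 * E2 z ^ 3 - (k + 2) / 4 * (E2 z * E₄ z)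
        + 1 / 3 * E₆ z) * F z := by
  have hD : D^[2] F = fun z => F₂ z + (k + 1) / 6 * (E2 z * F₁ z)
      + k / 144 * ((k + 1) * E2 z ^ 2 - E₄ z) * F z :=
    funext fun z => by rw [iterate_two_normalizedDeriv h₁ h₂, mul_assoc]
  have hPP := ((hasSerreDeriv_E2.pow 2).const_mul (k + 1)).changeWeight 4
  have h := ((h₃.changeWeight 0).add
    (((hasSerreDeriv_E2.mul h₂).const_mul ((k + 1) / 6)).changeWeight 0)).add
    ((((hPP.sub hasSerreDeriv_E₄).const_mul (k / 144)).mul h₁).changeWeight 0)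
  rw [Function.iterate_succ', Function.comp_apply, hD]
  refine ((h.congr (fun z => ?_) (fun _ => rfl) rfl).normalizedDeriv z).trans ?_
  · norm_num
  · push_cast
    ring

end HasSerreDeriv

lemma normalizedDeriv_E₄ (z : ℍ) : D E₄ z = 1 / 3 * (E2 z * E₄ z - E₆ z) := by
  rw [hasSerreDeriv_E₄.normalizedDeriv]
  ring

lemma normalizedDeriv_E₆ (z : ℍ) : D E₆ z = 1 / 2 * (E2 z * E₆ z - E₄ z ^ 2) := by
  rw [hasSerreDeriv_E₆.normalizedDeriv]
  ring

lemma iterate_two_normalizedDeriv_E₄ (z : ℍ) :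
    (D^[2] E₄) z = 5 / 36 * (E2 z ^ 2 * E₄ z - 2 * E2 z * E₆ z + E₄ z ^ 2) := by
  have h : HasSerreDeriv (4 + 2) (fun z => -(1 / 3) * E₆ z) _ :=
    (hasSerreDeriv_E₆.congr (fun _ => rfl) (fun _ => rfl) (by norm_num)).const_mul _
  rw [hasSerreDeriv_E₄.iterate_two_normalizedDeriv h]
  ring

lemma hasSerreDeriv_serreDerivative_E₆ :
    HasSerreDeriv (6 + 2) (fun z => -(1 / 2) * (E₄ z * E₄ z)) (fun z => 1 / 3 * (E₄ z * E₆ z)) :=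
  ((hasSerreDeriv_E₄.mul hasSerreDeriv_E₄).const_mul (-(1 / 2))).congr (fun _ => rfl)
    (fun z => by ring) (by norm_num)

lemma iterate_two_normalizedDeriv_E₆ (z : ℍ) :
    (D^[2] E₆) z = 7 / 24 * (E2 z ^ 2 * E₆ z - 2 * E2 z * E₄ z ^ 2 + E₄ z * E₆ z) := by
  rw [hasSerreDeriv_E₆.iterate_two_normalizedDeriv hasSerreDeriv_serreDerivative_E₆]
  ring

lemma hasSerreDeriv_E₄_mul_E₆ : HasSerreDeriv (6 + 4) (fun z => E₄ z * E₆ z)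
    (fun z => -(1 / 3) * E₆ z ^ 2 - 1 / 2 * E₄ z ^ 3) :=
  (hasSerreDeriv_E₄.mul hasSerreDeriv_E₆).congr (fun _ => rfl) (fun z => by ring) (by norm_num)

lemma iterate_three_normalizedDeriv_E₆ (z : ℍ) :
    (D^[3] E₆) z = 7 / 72 * (2 * E2 z ^ 3 * E₆ z - 6 * E2 z ^ 2 * E₄ z ^ 2
      + 6 * E2 z * E₄ z * E₆ z - E₄ z ^ 3 - E₆ z ^ 2) := by
  rw [hasSerreDeriv_E₆.iterate_three_normalizedDeriv hasSerreDeriv_serreDerivative_E₆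
    (hasSerreDeriv_E₄_mul_E₆.const_mul (1 / 3))]
  ring

lemma iterate_two_normalizedDeriv_E₄_mul_E₆ (z : ℍ) :
    (D^[2] fun τ => E₄ τ * E₆ τ) z = 1 / 72 * (55 * E2 z ^ 2 * E₄ z * E₆ z
      - 44 * E2 z * E₆ z ^ 2 - 66 * E2 z * E₄ z ^ 3 + 55 * E₄ z ^ 2 * E₆ z) := by
  have h : HasSerreDeriv (6 + 4 + 2) (fun z => -(1 / 3) * E₆ z ^ 2 - 1 / 2 * E₄ z ^ 3) _ :=
    (((hasSerreDeriv_monomial 0 0 2 _).const_mul (-(1 / 3))).sub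
      ((hasSerreDeriv_monomial 0 3 0 _).const_mul (1 / 2))).congr
      (fun z => by ring) (fun _ => rfl) rfl
  rw [hasSerreDeriv_E₄_mul_E₆.iterate_two_normalizedDeriv h]
  norm_num
  ring

lemma iterate_two_normalizedDeriv_E₄_sq_mul_E₆ (z : ℍ) :
    (D^[2] fun τ => E₄ τ ^ 2 * E₆ τ) z = 1 / 72 * (105 * E2 z ^ 2 * E₄ z ^ 2 * E₆ z
      - 120 * E2 z * E₄ z * E₆ z ^ 2 - 90 * E2 z * E₄ z ^ 4 + 89 * E₄ z ^ 3 * E₆ z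
      + 16 * E₆ z ^ 3) := by
  have h₁ : HasSerreDeriv 14 (fun z => E₄ z ^ 2 * E₆ z)
      (fun z => -(2 / 3) * (E₄ z * E₆ z ^ 2) - 1 / 2 * E₄ z ^ 4) :=
    (hasSerreDeriv_monomial 0 2 1 14).congr (fun z => by ring) (fun z => by norm_num) rfl
  have h₂ : HasSerreDeriv (14 + 2) (fun z => -(2 / 3) * (E₄ z * E₆ z ^ 2) - 1 / 2 * E₄ z ^ 4) _ :=
    (((hasSerreDeriv_monomial 0 1 2 _).const_mul (-(2 / 3))).sub
      ((hasSerreDeriv_monomial 0 4 0 _).const_mul (1 / 2))).congr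
      (fun z => by ring) (fun _ => rfl) rfl
  rw [h₁.iterate_two_normalizedDeriv h₂]
  norm_num
  ring

/-! ### Contiguity relations -/

/-- The denominator of the recurrence. -/
def recDen (w : ℂ) : ℂ := 16000 * (w - 3) * (w - 4) * (w - 5) * (w - 9) * (w - 11) * (w - 16)

/-- The coefficient of `E₄ f_w` in the recurrence. -/
def recA (w : ℂ) : ℂ := 200 * (w - 9) * (w - 10) * (w ^ 2 - 21 * w + 92)

/-- The negated coefficient of `E₄² f_{w-4}` in the recurrence. -/
noncomputable def recB (w : ℂ) : ℂ := 5 / 8 * (w - 10) * (w - 14)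

/-- The negated coefficient of `E₄ f_{w+4}` in `FirstOrderRel`. -/
def contA (w : ℂ) : ℂ := 100 * w ^ 3 - 1620 * w ^ 2 + 7520 * w - 9600

/-- The coefficient of `f_{w+8}` in `FirstOrderRel`. -/
def contB (w : ℂ) : ℂ := 9600 * (w + 1) * w * (w - 1) * (w - 5) * (w - 12)

/-- The coefficient of `f_{w+4}` in `SecondOrderRel`. -/
noncomputable def contC (w : ℂ) : ℂ := -(10 / 3) * (w - 3) * (w - 4) * (w - 5) * (w - 16)

/-- The first order contiguity relation. Here `Q` and `R` are the values of `E₄` and `E₆` at a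
point, `c`, `d`, `e` those of `f_w`, `f_{w+4}`, `f_{w+8}`, and `c₁` that of `∂ f_w`. -/
def FirstOrderRel (w Q R c d e c₁ : ℂ) : Prop :=
  R * c₁ = (w - 8) / 6 * Q ^ 2 * c - contA w * Q * d + contB w * e

/-- The second order contiguity relation, in the notation of `FirstOrderRel`; `c₂` is the value of
`∂² f_w`. -/
def SecondOrderRel (w Q c d c₂ : ℂ) : Prop :=
  c₂ = (w - 8) * (w - 9) / 36 * Q * c + contC w * d

/-- The recurrence cleared of denominators; `a`, `b`, `c`, `d` are the values of `f_{w-8}`,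
`f_{w-4}`, `f_w`, `f_{w+4}` and `Δ` is the value of the discriminant. -/
def RecurrenceRel (w Q Δ a b c d : ℂ) : Prop :=
  recDen w * d = recA w * (Q * c) - recB w * (Q ^ 2 * b) + Δ * a

/-- The Serre derivative of `RecurrenceRel`; `a₁`, `b₁`, `c₁`, `d₁` are the values of the Serre
derivatives. -/
def RecurrenceDerivRel (w Q R Δ b c a₁ b₁ c₁ d₁ : ℂ) : Prop :=
  recDen w * d₁ = recA w * (-(1 / 3) * R * c + Q * c₁)
    - recB w * (-(2 / 3) * (Q * R) * b + Q ^ 2 * b₁) + Δ * a₁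

/-- The second Serre derivative of `RecurrenceRel`, in the notation of `RecurrenceDerivRel`; `a₂`,
`b₂`, `c₂`, `d₂` are the values of the second Serre derivatives. -/
def RecurrenceSecondDerivRel (w Q R Δ b c b₁ c₁ a₂ b₂ c₂ d₂ : ℂ) : Prop :=
  recDen w * d₂ = recA w * (1 / 6 * Q ^ 2 * c - 2 / 3 * R * c₁ + Q * c₂)
    - recB w * ((2 / 9 * R ^ 2 + 1 / 3 * Q ^ 3) * b - 4 / 3 * (Q * R) * b₁ + Q ^ 2 * b₂) + Δ * a₂

section Relations

variable {w Q R Δ a b c d e g a₁ b₁ c₁ d₁ a₂ b₂ c₂ c₃ d₂ : ℂ}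

lemma FirstOrderRel.step (hN : recDen w ≠ 0) (hΔ : 1728 * Δ = Q ^ 3 - R ^ 2)
    (h1 : RecurrenceRel w Q Δ a b c d) (h2 : RecurrenceRel (w + 4) Q Δ b c d e)
    (h3 : RecurrenceRel (w + 8) Q Δ c d e g)
    (hd₁ : RecurrenceDerivRel w Q R Δ b c a₁ b₁ c₁ d₁)
    (ha : FirstOrderRel (w - 8) Q R a b c a₁) (hb : FirstOrderRel (w - 4) Q R b c d b₁)
    (hc : FirstOrderRel w Q R c d e c₁) :
    FirstOrderRel (w + 4) Q R d e g d₁ := by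
  apply mul_left_cancel₀ hN
  unfold FirstOrderRel RecurrenceRel RecurrenceDerivRel at *
  linear_combination (norm := skip) R * hd₁ + recA w * Q * hc - recB w * Q ^ 2 * hb + Δ * ha
    - (w - 16) / 6 * Q ^ 2 * h1
    + (100 * w ^ 3 - 3300 * w ^ 2 + 35360 * w - 123840) * Q * h2
    - 9600 * (w - 4) * (w - 5) * (w - 9) * (w - 11) * (w - 16) * h3
    - (recA w / 3 * c - 2 / 3 * recB w * Q * b) * hΔ
  simp only [recDen, recA, recB, contA, contB]
  ring

lemma SecondOrderRel.step (hN : recDen w ≠ 0) (hΔ : 1728 * Δ = Q ^ 3 - R ^ 2)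
    (h1 : RecurrenceRel w Q Δ a b c d) (h2 : RecurrenceRel (w + 4) Q Δ b c d e)
    (hd₂ : RecurrenceSecondDerivRel w Q R Δ b c b₁ c₁ a₂ b₂ c₂ d₂)
    (hb : FirstOrderRel (w - 4) Q R b c d b₁) (hc : FirstOrderRel w Q R c d e c₁)
    (ka : SecondOrderRel (w - 8) Q a b a₂) (kb : SecondOrderRel (w - 4) Q b c b₂)
    (kc : SecondOrderRel w Q c d c₂) :
    SecondOrderRel (w + 4) Q d e d₂ := by
  apply mul_left_cancel₀ hN
  unfold FirstOrderRel SecondOrderRel RecurrenceRel RecurrenceSecondDerivRel at *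
  linear_combination (norm := skip) hd₂ + recA w * Q * kc - recB w * Q ^ 2 * kb + Δ * ka
    - (w - 16) * (w - 17) / 36 * Q * h1 - 2 / 3 * recA w * hc + 4 / 3 * recB w * Q * hb
    + 10 / 3 * (w - 9) * (w ^ 3 - 51 * w ^ 2 + 764 * w - 3456) * h2 - 2 / 9 * recB w * b * hΔ
  simp only [recDen, recA, recB, contA, contB, contC]
  ring

lemma serreODE_of_rel (hΔ : 1728 * Δ = Q ^ 3 - R ^ 2)
    (hc : FirstOrderRel w Q R c d e c₁) (hd : FirstOrderRel (w + 4) Q R d e g d₁)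
    (kc : SecondOrderRel w Q c d c₂) (hr : RecurrenceRel (w + 8) Q Δ c d e g)
    (hc₃ : c₃ = (w - 8) * (w - 9) / 36 * (-(1 / 3) * R * c + Q * c₁) + contC w * d₁) :
    R * c₃ + 1 / 2 * Q ^ 2 * c₂ - (3 * w ^ 2 - 48 * w + 224) / 144 * Q * R * c₁
      - ((3 * w ^ 2 - 48 * w + 224) / 288 * Q ^ 3
        + (w ^ 3 - 33 * w ^ 2 + 300 * w - 896) / 864 * R ^ 2) * c = 0 := by
  unfold FirstOrderRel SecondOrderRel RecurrenceRel at *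
  linear_combination (norm := skip) R * hc₃ + 1 / 2 * Q ^ 2 * kc + contC w * hd
    - 2 * (w - 4) * (w - 5) * (w - 16) * hr + (w - 4) * (w - 16) / 144 * Q * hc
    - (w - 4) * (w - 5) * (w - 16) / 864 * c * hΔ
  simp only [recDen, recA, recB, contA, contB, contC]
  ring

end Relations

/-- `F`, `F₄`, `F₈` behave like `f_w`, `f_{w+4}`, `f_{w+8}`: `F` is holomorphic and satisfies both
contiguity relations. -/
structure IsContiguous (w : ℂ) (F F₄ F₈ : ℍ → ℂ) : Prop where
  mdifferentiable : MDiff F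
  firstOrder (z : ℍ) :
    FirstOrderRel w (E₄ z) (E₆ z) (F z) (F₄ z) (F₈ z) (serreDerivative (w - 2) F z)
  secondOrder (z : ℍ) :
    SecondOrderRel w (E₄ z) (F z) (F₄ z) (serreDerivative w (serreDerivative (w - 2) F) z)

lemma IsContiguous.of_hasSerreDeriv {v w : ℂ} {F F₄ F₈ F' F'' : ℍ → ℂ} (hv : w - 2 = v)
    (h₁ : HasSerreDeriv v F F') (h₂ : HasSerreDeriv w F' F'')
    (first : ∀ z, FirstOrderRel w (E₄ z) (E₆ z) (F z) (F₄ z) (F₈ z) (F' z))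
    (second : ∀ z, SecondOrderRel w (E₄ z) (F z) (F₄ z) (F'' z)) : IsContiguous w F F₄ F₈ := by
  obtain rfl := hv
  obtain ⟨hF, rfl⟩ := h₁
  obtain ⟨-, rfl⟩ := h₂
  exact ⟨hF, first, second⟩

namespace IsContiguous

variable {v w : ℂ} {F F₄ F₈ : ℍ → ℂ}

lemma congr_weight (h : IsContiguous w F F₄ F₈) (hw : v = w) : IsContiguous v F F₄ F₈ :=
  hw ▸ h

lemma hasSerreDeriv (h : IsContiguous w F F₄ F₈) :
    HasSerreDeriv (w - 2) F (serreDerivative (w - 2) F) :=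
  .of_mdifferentiable _ h.mdifferentiable

lemma hasSerreDeriv_serreDerivative (h : IsContiguous w F F₄ F₈) :
    HasSerreDeriv w (serreDerivative (w - 2) F)
      (serreDerivative w (serreDerivative (w - 2) F)) :=
  .of_mdifferentiable _ h.hasSerreDeriv.mdifferentiable_deriv

end IsContiguous

section Recurrence

variable {w : ℂ} {a b c d a₁ b₁ c₁ d₁ a₂ b₂ c₂ d₂ : ℍ → ℂ}

lemma hasSerreDeriv_of_recurrenceRel (hN : recDen w ≠ 0)
    (hd : ∀ z, RecurrenceRel w (E₄ z) (discriminant z) (a z) (b z) (c z) (d z))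
    (hd₁ : ∀ z, RecurrenceDerivRel w (E₄ z) (E₆ z) (discriminant z) (b z) (c z)
      (a₁ z) (b₁ z) (c₁ z) (d₁ z))
    (ha : HasSerreDeriv (w - 10) a a₁) (hb : HasSerreDeriv (w - 6) b b₁)
    (hc : HasSerreDeriv (w - 2) c c₁) : HasSerreDeriv (w + 2) d d₁ := by
  have hQc := (hasSerreDeriv_E₄.mul hc).congr (l := w + 2) (fun _ => rfl) (fun _ => rfl) (by ring)
  have hQQb := ((hasSerreDeriv_E₄.pow 2).mul hb).congr (l := w + 2) (fun _ => rfl) (fun _ => rfl)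
    (by push_cast; ring)
  have hΔa := (hasSerreDeriv_discriminant.mul ha).congr (l := w + 2) (fun _ => rfl) (fun _ => rfl)
    (by ring)
  refine ((((hQc.const_mul (recA w)).sub (hQQb.const_mul (recB w))).add hΔa).const_mul
    (recDen w)⁻¹).congr (fun z => ?_) (fun z => ?_) rfl
  · exact (eq_inv_mul_iff_mul_eq₀ hN).mpr (hd z)
  · refine (eq_inv_mul_iff_mul_eq₀ hN).mpr ((hd₁ z).trans ?_)
    push_cast
    ring

lemma hasSerreDeriv_of_recurrenceDerivRel (hN : recDen w ≠ 0)
    (hd₁ : ∀ z, RecurrenceDerivRel w (E₄ z) (E₆ z) (discriminant z) (b z) (c z)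
      (a₁ z) (b₁ z) (c₁ z) (d₁ z))
    (hd₂ : ∀ z, RecurrenceSecondDerivRel w (E₄ z) (E₆ z) (discriminant z) (b z) (c z)
      (b₁ z) (c₁ z) (a₂ z) (b₂ z) (c₂ z) (d₂ z))
    (hb : HasSerreDeriv (w - 6) b b₁) (hc : HasSerreDeriv (w - 2) c c₁)
    (ha₁ : HasSerreDeriv (w - 8) a₁ a₂) (hb₁ : HasSerreDeriv (w - 4) b₁ b₂)
    (hc₁ : HasSerreDeriv w c₁ c₂) : HasSerreDeriv (w + 4) d₁ d₂ := by
  have hQc := (((hasSerreDeriv_E₆.const_mul (-(1 / 3))).mul hc).congr (l := w + 4) (fun _ => rfl)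
    (fun _ => rfl) (by ring)).add ((hasSerreDeriv_E₄.mul hc₁).congr (fun _ => rfl) (fun _ => rfl)
      (by ring))
  have hQQb := ((((hasSerreDeriv_E₄.mul hasSerreDeriv_E₆).const_mul (-(2 / 3))).mul hb).congr
    (l := w + 4) (fun _ => rfl) (fun _ => rfl) (by ring)).add
    (((hasSerreDeriv_E₄.pow 2).mul hb₁).congr (fun _ => rfl) (fun _ => rfl) (by push_cast; ring))
  have hΔa := (hasSerreDeriv_discriminant.mul ha₁).congr (l := w + 4) (fun _ => rfl)
    (fun _ => rfl) (by ring)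
  refine ((((hQc.const_mul (recA w)).sub (hQQb.const_mul (recB w))).add hΔa).const_mul
    (recDen w)⁻¹).congr (fun z => ?_) (fun z => ?_) rfl
  · exact (eq_inv_mul_iff_mul_eq₀ hN).mpr (hd₁ z)
  · refine (eq_inv_mul_iff_mul_eq₀ hN).mpr ((hd₂ z).trans ?_)
    push_cast
    ring

end Recurrence

lemma IsContiguous.step {w : ℂ} {F F₄ F₈ F₁₂ F₁₆ F₂₀ : ℍ → ℂ}
    (h₀ : IsContiguous (w - 8) F F₄ F₈) (hN : recDen w ≠ 0) (h₄ : IsContiguous (w - 4) F₄ F₈ F₁₂)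
    (h₈ : IsContiguous w F₈ F₁₂ F₁₆)
    (hr₀ : ∀ z, RecurrenceRel w (E₄ z) (discriminant z) (F z) (F₄ z) (F₈ z) (F₁₂ z))
    (hr₄ : ∀ z, RecurrenceRel (w + 4) (E₄ z) (discriminant z) (F₄ z) (F₈ z) (F₁₂ z) (F₁₆ z))
    (hr₈ : ∀ z, RecurrenceRel (w + 8) (E₄ z) (discriminant z) (F₈ z) (F₁₂ z) (F₁₆ z) (F₂₀ z)) :
    IsContiguous (w + 4) F₁₂ F₁₆ F₂₀ := by
  obtain ⟨d₁, hd₁⟩ : ∃ d₁ : ℍ → ℂ, ∀ z, RecurrenceDerivRel w (E₄ z) (E₆ z) (discriminant z)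
      (F₄ z) (F₈ z) (serreDerivative (w - 8 - 2) F z) (serreDerivative (w - 4 - 2) F₄ z)
      (serreDerivative (w - 2) F₈ z) (d₁ z) := by
    unfold RecurrenceDerivRel
    exact ⟨_, fun _ => mul_inv_cancel_left₀ hN _⟩
  obtain ⟨d₂, hd₂⟩ : ∃ d₂ : ℍ → ℂ, ∀ z, RecurrenceSecondDerivRel w (E₄ z) (E₆ z) (discriminant z)
      (F₄ z) (F₈ z) (serreDerivative (w - 4 - 2) F₄ z) (serreDerivative (w - 2) F₈ z)
      (serreDerivative (w - 8) (serreDerivative (w - 8 - 2) F) z)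
      (serreDerivative (w - 4) (serreDerivative (w - 4 - 2) F₄) z)
      (serreDerivative w (serreDerivative (w - 2) F₈) z) (d₂ z) := by
    unfold RecurrenceSecondDerivRel
    exact ⟨_, fun _ => mul_inv_cancel_left₀ hN _⟩
  have hF₄ := h₄.hasSerreDeriv.congr (l := w - 6) (fun _ => rfl) (fun _ => rfl) (by ring)
  refine .of_hasSerreDeriv (v := w + 2) (by ring)
    (hasSerreDeriv_of_recurrenceRel hN hr₀ hd₁
      (h₀.hasSerreDeriv.congr (fun _ => rfl) (fun _ => rfl) (by ring)) hF₄ h₈.hasSerreDeriv)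
    (hasSerreDeriv_of_recurrenceDerivRel hN hd₁ hd₂ hF₄ h₈.hasSerreDeriv
      h₀.hasSerreDeriv_serreDerivative h₄.hasSerreDeriv_serreDerivative
      h₈.hasSerreDeriv_serreDerivative)
    (fun z => .step hN (discriminant_relation z) (hr₀ z) (hr₄ z) (hr₈ z) (hd₁ z)
      (h₀.firstOrder z) (h₄.firstOrder z) (h₈.firstOrder z))
    (fun z => .step hN (discriminant_relation z) (hr₀ z) (hr₄ z) (hd₂ z)
      (h₄.firstOrder z) (h₈.firstOrder z) (h₀.secondOrder z) (h₄.secondOrder z)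
      (h₈.secondOrder z))

lemma recDen_ne_zero (k : ℕ) : recDen (4 * k + 18) ≠ 0 := by
  have hcast : recDen (4 * k + 18) =
      (16000 * (4 * k + 15) * (4 * k + 14) * (4 * k + 13) * (4 * k + 9) * (4 * k + 7)
        * (4 * k + 2) : ℕ) := by
    push_cast [recDen]
    ring
  rw [hcast]
  exact Nat.cast_ne_zero.mpr (by positivity)

namespace IsRecurrenceSequence

variable {f : ℕ → ℍ → ℂ}

lemma recurrenceRel (hf : IsRecurrenceSequence f) (k : ℕ) (z : ℍ) :
    RecurrenceRel (4 * k + 18) (E₄ z) (discriminant z) (f (4 * k + 10) z) (f (4 * k + 14) z)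
      (f (4 * k + 18) z) (f (4 * k + 22) z) := by
  have hrec : f (4 * k + 22) z = (recDen (4 * k + 18))⁻¹ * (recA (4 * k + 18) *
      (E₄ z * f (4 * k + 18) z) - recB (4 * k + 18) * (E₄ z ^ 2 * f (4 * k + 14) z)
        + discriminant z * f (4 * k + 10) z) := by
    have h := hf.recurrence (4 * k + 18) (by omega) (by omega) z
    push_cast at h
    rw [recDen, recA, recB, h]
    ring
  rw [RecurrenceRel, hrec, mul_inv_cancel_left₀ (recDen_ne_zero k)]

lemma eq_twentyTwo (hf : IsRecurrenceSequence f) (z : ℍ) :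
    f 22 z = (547200 * E₄ z * f 18 z - 20 * E₄ z ^ 2 * f 14 z + discriminant z * f 10 z) /
      (16000 * 15 * 14 * 13 * 9 * 7 * 2) := by
  have h := hf.recurrenceRel 0 z
  norm_num [RecurrenceRel, recDen, recA, recB] at h
  linear_combination h / (16000 * 15 * 14 * 13 * 9 * 7 * 2)

lemma eq_twentySix (hf : IsRecurrenceSequence f) (z : ℍ) :
    f 26 z = (3556800 * E₄ z * f 22 z - 60 * E₄ z ^ 2 * f 18 z + discriminant z * f 14 z) /
      (16000 * 19 * 18 * 17 * 13 * 11 * 6) := by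
  have h := hf.recurrenceRel 1 z
  norm_num [RecurrenceRel, recDen, recA, recB] at h
  linear_combination h / (16000 * 19 * 18 * 17 * 13 * 11 * 6)

lemma hasSerreDeriv_ten (hf : IsRecurrenceSequence f) : HasSerreDeriv 8 (f 10) (fun z =>
    1 / 3 * (E₄ z ^ 3 + E₆ z ^ 2 - 4 * E2 z * E₄ z * E₆ z + 2 * E2 z ^ 2 * E₄ z ^ 2)) :=
  ((((hasSerreDeriv_monomial 1 2 0 8).const_mul 2).sub (hasSerreDeriv_monomial 0 1 1 8)).sub
    (hasSerreDeriv_monomial 2 0 1 8)).congr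
    (fun z => by rw [hf.init_ten]; ring) (fun z => by norm_num; ring) rfl

lemma isContiguous_ten (hf : IsRecurrenceSequence f) : IsContiguous 10 (f 10) (f 14) (f 18) := by
  have h := (((hasSerreDeriv_monomial 0 3 0 10).add (hasSerreDeriv_monomial 0 0 2 10)).add
    (((hasSerreDeriv_monomial 1 1 1 10).const_mul (-4)).add
      ((hasSerreDeriv_monomial 2 2 0 10).const_mul 2))).const_mul (1 / 3)
  refine .of_hasSerreDeriv (by norm_num) hf.hasSerreDeriv_ten
    (h.congr (fun z => by ring) (fun _ => rfl) rfl) (fun z => ?_) (fun z => ?_)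
  · rw [FirstOrderRel, hf.init_ten, hf.init_fourteen, hf.init_eighteen, contA, contB]
    ring
  · rw [SecondOrderRel, hf.init_ten, hf.init_fourteen, contC]
    norm_num
    ring

lemma hasSerreDeriv_fourteen (hf : IsRecurrenceSequence f) : HasSerreDeriv 12 (f 14) (fun z =>
    1 / 100800 * (7 * E₄ z * E₆ z ^ 2 + 5 * E₄ z ^ 4 - 24 * E2 z * E₄ z ^ 2 * E₆ z
      + E2 z ^ 2 * (5 * E₆ z ^ 2 + 7 * E₄ z ^ 3))) :=
  ((((hasSerreDeriv_monomial 0 2 1 12).sub ((hasSerreDeriv_monomial 1 3 0 12).add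
    (hasSerreDeriv_monomial 1 0 2 12))).add (hasSerreDeriv_monomial 2 1 1 12)).const_mul
    (-(1 / 8400))).congr
    (fun z => by rw [hf.init_fourteen]; ring) (fun z => by norm_num; ring) rfl

lemma isContiguous_fourteen (hf : IsRecurrenceSequence f) :
    IsContiguous 14 (f 14) (f 18) (f 22) := by
  have h := ((((hasSerreDeriv_monomial 0 1 2 14).const_mul 7).add
    ((hasSerreDeriv_monomial 0 4 0 14).const_mul 5)).add
    (((hasSerreDeriv_monomial 1 2 1 14).const_mul (-24)).add
      (((hasSerreDeriv_monomial 2 0 2 14).const_mul 5).add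
        ((hasSerreDeriv_monomial 2 3 0 14).const_mul 7)))).const_mul (1 / 100800)
  refine .of_hasSerreDeriv (by norm_num) hf.hasSerreDeriv_fourteen
    (h.congr (fun z => by ring) (fun _ => rfl) rfl) (fun z => ?_) (fun z => ?_)
  · rw [FirstOrderRel, hf.eq_twentyTwo, hf.init_ten, hf.init_fourteen, hf.init_eighteen,
      discriminant_eq_E₄_cube_sub_E₆_sq, contA, contB]
    ring
  · rw [SecondOrderRel, hf.init_fourteen, hf.init_eighteen, contC]
    norm_num
    ring

lemma hasSerreDeriv_eighteen (hf : IsRecurrenceSequence f) : HasSerreDeriv 16 (f 18) (fun z =>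
    1 / 23950080000 * (167 * E₄ z ^ 2 * E₆ z ^ 2 + 25 * E₄ z ^ 5
      - E2 z * (294 * E₄ z ^ 3 * E₆ z + 90 * E₆ z ^ 3)
      + E2 z ^ 2 * (115 * E₄ z * E₆ z ^ 2 + 77 * E₄ z ^ 4))) :=
  (((((hasSerreDeriv_monomial 0 3 1 16).const_mul 5).add
    ((hasSerreDeriv_monomial 0 0 3 16).const_mul 7)).sub
    (((hasSerreDeriv_monomial 1 4 0 16).const_mul 5).add
      ((hasSerreDeriv_monomial 1 1 2 16).const_mul 19))).add
    ((hasSerreDeriv_monomial 2 2 1 16).const_mul 12)).const_mul (-(1 / 1995840000)) |>.congr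
    (fun z => by rw [hf.init_eighteen]; ring) (fun z => by norm_num; ring) rfl

lemma isContiguous_eighteen (hf : IsRecurrenceSequence f) :
    IsContiguous 18 (f 18) (f 22) (f 26) := by
  have h := ((((hasSerreDeriv_monomial 0 2 2 18).const_mul 167).add
    ((hasSerreDeriv_monomial 0 5 0 18).const_mul 25)).sub
    (((hasSerreDeriv_monomial 1 3 1 18).const_mul 294).add
      ((hasSerreDeriv_monomial 1 0 3 18).const_mul 90))).add
    (((hasSerreDeriv_monomial 2 1 2 18).const_mul 115).add
      ((hasSerreDeriv_monomial 2 4 0 18).const_mul 77)) |>.const_mul (1 / 23950080000)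
  refine .of_hasSerreDeriv (by norm_num) hf.hasSerreDeriv_eighteen
    (h.congr (fun z => by ring) (fun _ => rfl) rfl) (fun z => ?_) (fun z => ?_)
  · rw [FirstOrderRel, hf.eq_twentySix, hf.eq_twentyTwo, hf.init_ten, hf.init_fourteen,
      hf.init_eighteen, discriminant_eq_E₄_cube_sub_E₆_sq, contA, contB]
    ring
  · rw [SecondOrderRel, hf.eq_twentyTwo, hf.init_ten, hf.init_fourteen, hf.init_eighteen,
      discriminant_eq_E₄_cube_sub_E₆_sq, contC]
    norm_num
    ring

theorem isContiguous (hf : IsRecurrenceSequence f) : ∀ k : ℕ,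
    IsContiguous (4 * k + 10) (f (4 * k + 10)) (f (4 * k + 14)) (f (4 * k + 18))
  | 0 => by simpa using hf.isContiguous_ten
  | 1 => by norm_num; exact hf.isContiguous_fourteen
  | 2 => by norm_num; exact hf.isContiguous_eighteen
  | k + 3 => by
    have hr₄ := hf.recurrenceRel (k + 1)
    have hr₈ := hf.recurrenceRel (k + 2)
    rw [show (4 * (k + 1 : ℕ) + 18 : ℂ) = 4 * k + 18 + 4 by push_cast; ring] at hr₄
    rw [show (4 * (k + 2 : ℕ) + 18 : ℂ) = 4 * k + 18 + 8 by push_cast; ring] at hr₈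
    exact (((hf.isContiguous k).congr_weight (by ring)).step (recDen_ne_zero k)
      ((hf.isContiguous (k + 1)).congr_weight (by push_cast; ring))
      ((hf.isContiguous (k + 2)).congr_weight (by push_cast; ring))
      (hf.recurrenceRel k) hr₄ hr₈).congr_weight (by push_cast; ring)

end IsRecurrenceSequence

lemma solvesODE_of_serreODE {w : ℂ} {F F₁ F₂ F₃ : ℍ → ℂ} (h₁ : HasSerreDeriv (w - 2) F F₁)
    (h₂ : HasSerreDeriv w F₁ F₂) (h₃ : HasSerreDeriv (w + 2) F₂ F₃)
    (hODE : ∀ z, E₆ z * F₃ z + 1 / 2 * E₄ z ^ 2 * F₂ z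
      - (3 * w ^ 2 - 48 * w + 224) / 144 * E₄ z * E₆ z * F₁ z
      - ((3 * w ^ 2 - 48 * w + 224) / 288 * E₄ z ^ 3
        + (w ^ 3 - 33 * w ^ 2 + 300 * w - 896) / 864 * E₆ z ^ 2) * F z = 0) :
    SolvesODE w F := by
  replace h₂ := h₂.congr (l := w - 2 + 2) (fun _ => rfl) (fun _ => rfl) (by ring)
  replace h₃ := h₃.congr (l := w - 2 + 4) (fun _ => rfl) (fun _ => rfl) (by ring)
  intro z
  rw [h₁.iterate_three_normalizedDeriv h₂ h₃, h₁.iterate_two_normalizedDeriv h₂,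
    h₁.normalizedDeriv, normalizedDeriv_E₄, normalizedDeriv_E₆, iterate_two_normalizedDeriv_E₄,
    iterate_two_normalizedDeriv_E₆, iterate_three_normalizedDeriv_E₆]
  linear_combination hODE z

lemma IsContiguous.solvesODE {w : ℂ} {F F₄ F₈ F₁₂ : ℍ → ℂ} (h : IsContiguous w F F₄ F₈)
    (h₄ : IsContiguous (w + 4) F₄ F₈ F₁₂)
    (hr : ∀ z, RecurrenceRel (w + 8) (E₄ z) (discriminant z) (F z) (F₄ z) (F₈ z) (F₁₂ z)) :
    SolvesODE w F := by
  have hQF := (hasSerreDeriv_E₄.mul h.hasSerreDeriv).congr (l := w + 2) (fun _ => rfl)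
    (fun _ => rfl) (by ring)
  have hF₄ := h₄.hasSerreDeriv.congr (l := w + 2) (fun _ => rfl) (fun _ => rfl) (by ring)
  have h₃ := (hQF.const_mul ((w - 8) * (w - 9) / 36)).add (hF₄.const_mul (contC w))
  refine solvesODE_of_serreODE h.hasSerreDeriv h.hasSerreDeriv_serreDerivative
    (h₃.congr (fun z => ?_) (fun _ => rfl) rfl) fun z =>
      serreODE_of_rel (discriminant_relation z) (h.firstOrder z) (h₄.firstOrder z)
        (h.secondOrder z) (hr z) rfl
  rw [h.secondOrder z, mul_assoc]

/-! ### Quasimodular forms of depth two -/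

/-- The functions `F = A - 2 E₂ B + E₂² C`, `G = B - E₂ C`, `H = C` built from holomorphic modular
forms `A`, `B`, `C` of weights `w`, `w - 2`, `w - 4`, characterized by solving for `A`, `B`, `C`. -/
structure IsQuasimodularTriple (w : ℤ) (F G H : ℍ → ℂ) : Prop where
  isModular_A : IsModular w fun z => F z + 2 * E2 z * G z + E2 z ^ 2 * H z
  isModular_B : IsModular (w - 2) fun z => G z + E2 z * H z
  isModular_C : IsModular (w - 4) H

namespace IsQuasimodularTriple

variable {v w : ℤ} {F F₁ F₂ G G₁ G₂ H H₁ H₂ : ℍ → ℂ}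

lemma congr (h : IsQuasimodularTriple w F₁ G H) (hF : ∀ z, F₂ z = F₁ z) (hw : v = w) :
    IsQuasimodularTriple v F₂ G H := by
  obtain rfl : F₂ = F₁ := funext hF
  exact hw ▸ h

lemma sub (h₁ : IsQuasimodularTriple w F₁ G₁ H₁) (h₂ : IsQuasimodularTriple w F₂ G₂ H₂) :
    IsQuasimodularTriple w (fun z => F₁ z - F₂ z) (fun z => G₁ z - G₂ z)
      (fun z => H₁ z - H₂ z) where
  isModular_A := (h₁.isModular_A.sub h₂.isModular_A).congr (fun z => by ring) rfl
  isModular_B := (h₁.isModular_B.sub h₂.isModular_B).congr (fun z => by ring) rfl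
  isModular_C := h₁.isModular_C.sub h₂.isModular_C

lemma const_mul (a : ℂ) (h : IsQuasimodularTriple w F G H) :
    IsQuasimodularTriple w (fun z => a * F z) (fun z => a * G z) (fun z => a * H z) where
  isModular_A := (h.isModular_A.const_mul a).congr (fun z => by ring) rfl
  isModular_B := (h.isModular_B.const_mul a).congr (fun z => by ring) rfl
  isModular_C := h.isModular_C.const_mul a

lemma modular_mul {M : ℍ → ℂ} (hM : IsModular v M) (h : IsQuasimodularTriple w F G H) :
    IsQuasimodularTriple (w + v) (fun z => M z * F z) (fun z => M z * G z)
      (fun z => M z * H z) where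
  isModular_A := (hM.mul h.isModular_A).congr (fun z => by ring) (by ring)
  isModular_B := (hM.mul h.isModular_B).congr (fun z => by ring) (by ring)
  isModular_C := (hM.mul h.isModular_C).congr (fun z => rfl) (by ring)

lemma mdifferentiable_middle (h : IsQuasimodularTriple w F G H) : MDiff G := by
  have hG : G = fun z => (G z + E2 z * H z) - E2 z * H z := by ext z; ring
  rw [hG]
  exact h.isModular_B.mdifferentiable.sub (E2_mdifferentiable.mul h.isModular_C.mdifferentiable)

lemma mdifferentiable_top (h : IsQuasimodularTriple w F G H) : MDiff F := by
  have hF : F = fun z => (F z + 2 * E2 z * G z + E2 z ^ 2 * H z) - 2 * E2 z * G z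
      - E2 z ^ 2 * H z := by
    ext z
    ring
  rw [hF]
  exact (h.isModular_A.mdifferentiable.sub
    ((E2_mdifferentiable.const_smul (2 : ℂ)).mul h.mdifferentiable_middle)).sub
    ((E2_mdifferentiable.pow 2).mul h.isModular_C.mdifferentiable)

lemma serreDerivative {u : ℂ} (h : IsQuasimodularTriple w F G H) (hu : u = w - 2) :
    IsQuasimodularTriple (w + 2) (serreDerivative u F)
      (fun z => serreDerivative u G z - 1 / 12 * F z)
      (fun z => serreDerivative u H z - 1 / 6 * G z) := by
  have hF := HasSerreDeriv.of_mdifferentiable u h.mdifferentiable_top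
  have hG := HasSerreDeriv.of_mdifferentiable u h.mdifferentiable_middle
  have hH := HasSerreDeriv.of_mdifferentiable u h.isModular_C.mdifferentiable
  have hB := (hG.changeWeight (w - 2 : ℤ)).add
    ((hasSerreDeriv_E2.mul hH).changeWeight (w - 2 : ℤ))
  have hA := ((hF.changeWeight w).add
    (((hasSerreDeriv_E2.const_mul 2).mul hG).changeWeight w)).add
    (((hasSerreDeriv_E2.pow 2).mul hH).changeWeight w)
  constructor
  · refine (h.isModular_A.serreDerivative.add
      ((isModular_E₄.mul h.isModular_B).const_mul (1 / 6) |>.congr (fun _ => rfl) (by ring))).congr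
      (fun z => ?_) rfl
    rw [hA.2, hu]
    push_cast
    ring
  · refine (h.isModular_B.serreDerivative.add
      (((isModular_E₄.mul h.isModular_C).congr (l := w) (fun _ => rfl) (by ring) |>.sub
        h.isModular_A).const_mul (1 / 12) |>.congr (fun _ => rfl) (by ring))).congr
      (fun z => ?_) (by ring)
    rw [hB.2, hu]
    push_cast
    ring
  · refine (h.isModular_C.serreDerivative.sub
      ((h.isModular_B.const_mul (1 / 6)).congr (fun _ => rfl) (by ring))).congr
      (fun z => ?_) (by ring)
    rw [(hH.changeWeight (w - 4 : ℤ)).2, hu]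
    push_cast
    ring

lemma exists_of_secondOrderRel {F₄ : ℍ → ℂ} {φ γ χ : ℂ} (h : IsQuasimodularTriple w F G H)
    (hw : contC w ≠ 0)
    (hF₄ : ∀ z, SecondOrderRel w (E₄ z) (F z) (F₄ z)
      (Derivative.serreDerivative w (Derivative.serreDerivative (w - 2) F) z))
    (hφ : HasLeadingTerm F 1 φ) (hγ : HasLeadingTerm G 1 γ) (hχ : HasLeadingTerm H 0 χ) :
    ∃ G₄ H₄, IsQuasimodularTriple (w + 4) F₄ G₄ H₄ ∧
      HasLeadingTerm G₄ 1 ((contC w)⁻¹ * (-(w - 4) * (w - 10) / 48 * γ - (13 - w) / 72 * φ)) ∧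
      HasLeadingTerm H₄ 0 ((contC w)⁻¹ * (-(w - 6) * (w - 16) / 48 * χ)) := by
  have h₂ := (h.serreDerivative rfl).serreDerivative (u := w) (by push_cast; ring)
  have hQ := (h.modular_mul isModular_E₄).const_mul ((w - 8) * (w - 9) / 36)
  refine ⟨_, _, (((h₂.congr (fun _ => rfl) (by ring)).sub hQ).const_mul (contC w)⁻¹).congr
    (fun z => ?_) rfl, ?_, ?_⟩
  · rw [hF₄ z]
    field_simp
    ring
  · refine (((((hγ.serreDerivative (w - 2)).sub (hφ.const_mul (1 / 12))).serreDerivative w).sub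
      ((hφ.serreDerivative (w - 2)).const_mul (1 / 12))).sub
      ((hasLeadingTerm_E₄.mul_of_zero_exponent hγ).const_mul ((w - 8) * (w - 9) / 36))
      |>.const_mul (contC w)⁻¹).congr (fun _ => rfl) ?_
    push_cast
    ring
  · have hφ' := hφ.zero_of_lt one_pos
    have hγ' := hγ.zero_of_lt one_pos
    refine (((((hχ.serreDerivative (w - 2)).sub (hγ'.const_mul (1 / 6))).serreDerivative w).sub
      (((hγ'.serreDerivative (w - 2)).sub (hφ'.const_mul (1 / 12))).const_mul (1 / 6))).sub
      ((hasLeadingTerm_E₄.mul_of_zero_exponent hχ).const_mul ((w - 8) * (w - 9) / 36))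
      |>.const_mul (contC w)⁻¹).congr (fun _ => rfl) ?_
    push_cast
    ring

end IsQuasimodularTriple

lemma HasLeadingTerm.exists_succ_of_secondOrderRel {w : ℂ} {F F₄ : ℍ → ℂ} {n : ℕ} {φ : ℂ}
    (h : HasLeadingTerm F n φ) (hn : w = 4 * n + 6) (hw : contC w ≠ 0)
    (hF₄ : ∀ z, SecondOrderRel w (E₄ z) (F z) (F₄ z)
      (Derivative.serreDerivative w (Derivative.serreDerivative (w - 2) F) z)) :
    ∃ ψ, HasLeadingTerm F₄ (n + 1) ψ := by
  refine HasLeadingTerm.exists_succ (((((h.serreDerivative (w - 2)).serreDerivative w).sub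
    ((hasLeadingTerm_E₄.mul_of_zero_exponent h).const_mul ((w - 8) * (w - 9) / 36))).const_mul
    (contC w)⁻¹).congr (fun z => ?_) ?_)
  · rw [hF₄ z]
    field_simp
    ring
  · rw [hn]
    ring

lemma contC_ne_zero (k : ℕ) : contC (4 * k + 10) ≠ 0 := by
  have hcast : contC (4 * k + 10) =
      -(10 / 3) * ((4 * k + 7) * (4 * k + 6) * (4 * k + 5) * (4 * k - 6) : ℤ) := by
    push_cast [contC]
    ring
  have hlast : (4 * k - 6 : ℤ) ≠ 0 := by omega
  rw [hcast]
  exact mul_ne_zero (by norm_num) (Int.cast_ne_zero.mpr (by positivity))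

/-! ### The recurrence sequence -/

namespace IsRecurrenceSequence

variable {f : ℕ → ℍ → ℂ}

theorem solvesODE (hf : IsRecurrenceSequence f) (k : ℕ) :
    SolvesODE (4 * k + 10) (f (4 * k + 10)) := by
  refine (hf.isContiguous k).solvesODE
    ((hf.isContiguous (k + 1)).congr_weight (by push_cast; ring)) fun z => ?_
  rw [show (4 * k + 10 + 8 : ℂ) = 4 * k + 18 by ring]
  exact hf.recurrenceRel k z

lemma init_ten_eq_deriv (hf : IsRecurrenceSequence f) (z : ℍ) :
    f 10 z = -(24 / 7) * (D^[2] E₆) z := by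
  rw [hf.init_ten, iterate_two_normalizedDeriv_E₆]
  ring

lemma init_fourteen_eq_deriv (hf : IsRecurrenceSequence f) (z : ℍ) :
    f 14 z = -(3 / 19250) * (D^[2] (fun τ => E₄ τ * E₆ τ)) z
      - 36 / 875 * (E2 z * discriminant z) := by
  rw [hf.init_fourteen, iterate_two_normalizedDeriv_E₄_mul_E₆, discriminant_eq_E₄_cube_sub_E₆_sq]
  ring

lemma init_eighteen_eq_deriv (hf : IsRecurrenceSequence f) (z : ℍ) :
    f 18 z = -(1 / 242550000) * (D^[2] (fun τ => E₄ τ ^ 2 * E₆ τ)) z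
      + discriminant z * (181 * E₆ z - 185 * (E2 z * E₄ z)) / 40425000 := by
  rw [hf.init_eighteen, iterate_two_normalizedDeriv_E₄_sq_mul_E₆,
    discriminant_eq_E₄_cube_sub_E₆_sq]
  ring

lemma hasLeadingTerm_ten (hf : IsRecurrenceSequence f) : HasLeadingTerm (f 10) 1 1728 :=
  (hasLeadingTerm_normalizedDeriv_E₆.normalizedDeriv.const_mul (-(24 / 7))).congr
    hf.init_ten_eq_deriv (by norm_num)

lemma exists_hasLeadingTerm (hf : IsRecurrenceSequence f) :
    ∀ k : ℕ, ∃ φ, HasLeadingTerm (f (4 * k + 10)) (k + 1) φ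
  | 0 => ⟨1728, hf.hasLeadingTerm_ten⟩
  | k + 1 => by
    obtain ⟨φ, hφ⟩ := hf.exists_hasLeadingTerm k
    exact hφ.exists_succ_of_secondOrderRel (by push_cast; ring) (contC_ne_zero k)
      (hf.isContiguous k).secondOrder

lemma leadingCoeff_eq (hf : IsRecurrenceSequence f) {k : ℕ} {φ ψ : ℂ}
    (hφ : HasLeadingTerm (f (4 * k + 10)) (k + 1) φ)
    (hψ : HasLeadingTerm (f (4 * k + 14)) (k + 2) ψ) : φ = recB (4 * k + 18) * ψ := by
  obtain ⟨χ, hχ⟩ := hf.exists_hasLeadingTerm (k + 2)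
  obtain ⟨ω, hω⟩ := hf.exists_hasLeadingTerm (k + 3)
  have hΔ : HasLeadingTerm (fun z => discriminant z * f (4 * k + 10) z) (k + 2) φ := by
    have h := hasLeadingTerm_discriminant.mul hφ
    rwa [one_mul, show 1 + (k + 1) = k + 2 by ring] at h
  have hrest := (((hω.zero_of_lt (m := k + 2) (by omega)).const_mul (recDen (4 * k + 18))).sub
    ((hasLeadingTerm_E₄.mul_of_zero_exponent (hχ.zero_of_lt (m := k + 2) (by omega))).const_mul
      (recA (4 * k + 18)))).add
    ((hasLeadingTerm_E₄.mul_of_zero_exponent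
      (hasLeadingTerm_E₄.mul_of_zero_exponent hψ)).const_mul (recB (4 * k + 18)))
  refine hΔ.unique (hrest.congr (fun z => ?_) (by ring))
  have h := hf.recurrenceRel k z
  rw [RecurrenceRel] at h
  linear_combination -h

lemma exists_hasLeadingTerm_ne_zero (hf : IsRecurrenceSequence f) :
    ∀ k : ℕ, ∃ φ ≠ 0, HasLeadingTerm (f (4 * k + 10)) (k + 1) φ
  | 0 => ⟨1728, by norm_num, hf.hasLeadingTerm_ten⟩
  | k + 1 => by
    obtain ⟨φ, hφ₀, hφ⟩ := hf.exists_hasLeadingTerm_ne_zero k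
    obtain ⟨ψ, hψ⟩ := hf.exists_hasLeadingTerm (k + 1)
    exact ⟨ψ, right_ne_zero_of_mul (hf.leadingCoeff_eq hφ hψ ▸ hφ₀), hψ⟩

lemma isQuasimodularTriple_ten (hf : IsRecurrenceSequence f) :
    IsQuasimodularTriple 10 (f 10) (fun z => 2 * D E₆ z) (fun z => -1 * E₆ z) where
  isModular_A := ((isModular_E₄.mul isModular_E₆).const_mul (-1)).congr
    (fun z => by rw [hf.init_ten, normalizedDeriv_E₆]; ring) (by norm_num)
  isModular_B := ((isModular_E₄.mul isModular_E₄).const_mul (-1)).congr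
    (fun z => by rw [normalizedDeriv_E₆]; ring) (by norm_num)
  isModular_C := (isModular_E₆.const_mul (-1)).congr (fun _ => rfl) (by norm_num)

lemma hasLeadingTerm_one (hf : IsRecurrenceSequence f) (k : ℕ) :
    HasLeadingTerm (f (4 * k + 10)) 1 (if k = 0 then 1728 else 0) := by
  split_ifs with hk
  · exact hk ▸ hf.hasLeadingTerm_ten
  · obtain ⟨φ, hφ⟩ := hf.exists_hasLeadingTerm k
    exact hφ.zero_of_lt (by omega)

/-- Only in weight `10` does the `q`-coefficient of `f_w` survive, and exactly there the
coefficient of `γ` vanishes. -/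
lemma middleCoeff_ne_zero (k : ℕ) {γ : ℂ} (hγ : γ ≠ 0) :
    -((4 * k + 10 : ℂ) - 4) * (4 * k + 10 - 10) / 48 * γ
      - (13 - (4 * k + 10)) / 72 * (if k = 0 then 1728 else 0) ≠ 0 := by
  split_ifs with hk
  · norm_num [hk]
  · have hcast : -((4 * k + 10 : ℂ) - 4) * (4 * k + 10 - 10) / 48 * γ
        - (13 - (4 * k + 10)) / 72 * 0 = (((4 * k + 6) * (4 * k) : ℕ) : ℂ) * (-1 / 48 * γ) := by
      push_cast
      ring
    rw [hcast]
    exact mul_ne_zero (Nat.cast_ne_zero.mpr (by positivity)) (mul_ne_zero (by norm_num) hγ)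

lemma bottomCoeff_ne_zero (k : ℕ) {χ : ℂ} (hχ : χ ≠ 0) :
    -((4 * k + 10 : ℂ) - 6) * (4 * k + 10 - 16) / 48 * χ ≠ 0 := by
  have hcast : -((4 * k + 10 : ℂ) - 6) * (4 * k + 10 - 16) / 48 * χ
      = (((4 * k + 4) * (4 * k - 6) : ℤ) : ℂ) * (-1 / 48 * χ) := by
    push_cast
    ring
  have hlast : (4 * k - 6 : ℤ) ≠ 0 := by omega
  rw [hcast]
  exact mul_ne_zero (Int.cast_ne_zero.mpr (by positivity)) (mul_ne_zero (by norm_num) hχ)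

theorem exists_isQuasimodularTriple (hf : IsRecurrenceSequence f) : ∀ k : ℕ,
    ∃ G H, IsQuasimodularTriple (4 * k + 10) (f (4 * k + 10)) G H ∧
      (∃ γ ≠ 0, HasLeadingTerm G 1 γ) ∧ ∃ χ ≠ 0, HasLeadingTerm H 0 χ
  | 0 => ⟨_, _, hf.isQuasimodularTriple_ten,
      ⟨_, by norm_num, hasLeadingTerm_normalizedDeriv_E₆.const_mul 2⟩,
      ⟨_, by norm_num, hasLeadingTerm_E₆.const_mul (-1)⟩⟩
  | k + 1 => by
    obtain ⟨G, H, h, ⟨γ, hγ₀, hγ⟩, χ, hχ₀, hχ⟩ := hf.exists_isQuasimodularTriple k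
    have hcast : ((4 * k + 10 : ℤ) : ℂ) = 4 * k + 10 := by push_cast; rfl
    have hcont := contC_ne_zero k
    have hsecond := (hf.isContiguous k).secondOrder
    rw [← hcast] at hcont hsecond
    obtain ⟨G₄, H₄, h₄, hG₄, hH₄⟩ :=
      h.exists_of_secondOrderRel hcont hsecond (hf.hasLeadingTerm_one k) hγ hχ
    rw [hcast] at hG₄ hH₄
    exact ⟨G₄, H₄, h₄.congr (fun _ => rfl) (by push_cast; ring),
      ⟨_, mul_ne_zero (inv_ne_zero (contC_ne_zero k)) (middleCoeff_ne_zero k hγ₀), hG₄⟩,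
      ⟨_, mul_ne_zero (inv_ne_zero (contC_ne_zero k)) (bottomCoeff_ne_zero k hχ₀), hH₄⟩⟩

end IsRecurrenceSequence

/-! ### Uniqueness of the decomposition -/

lemma IsModular.smul_apply {k : ℤ} {F : ℍ → ℂ} (h : IsModular k F) (γ : SL(2, ℤ)) (z : ℍ) :
    F (γ • z) = denom γ z ^ k * F z := by
  have hslash := congrFun (h.slash_eq γ) z
  rw [SL_slash_apply, zpow_neg] at hslash
  have := zpow_ne_zero k (denom_ne_zero γ z)
  rw [← hslash]
  field_simp

lemma E2_smul_apply (γ : SL(2, ℤ)) (z : ℍ) :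
    E2 (γ • z) = denom γ z ^ 2 *
      (E2 z + 12 * (2 * Real.pi * Complex.I)⁻¹ * γ 1 0 * (denom γ z)⁻¹) := by
  rw [← E2_slash_apply, SL_slash_apply, zpow_neg]
  have := denom_ne_zero γ z
  norm_cast
  field_simp

section Uniqueness

variable {w : ℤ} {A B C : ℍ → ℂ}

lemma mul_eq_denom_mul_of_combination_eq_zero (hA : IsModular w A) (hB : IsModular (w - 2) B)
    (hC : IsModular (w - 4) C) (h : ∀ z, A z - 2 * E2 z * B z + E2 z ^ 2 * C z = 0)
    {γ : SL(2, ℤ)} (hγ : γ 1 0 = 1) (z : ℍ) :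
    6 * (2 * Real.pi * Complex.I)⁻¹ * C z = denom γ z * (B z - E2 z * C z) := by
  have hj := denom_ne_zero γ z
  have hz := h z
  have hγz := h (γ • z)
  rw [hA.smul_apply, hB.smul_apply, hC.smul_apply, E2_smul_apply, hγ, zpow_sub₀ hj,
    zpow_sub₀ hj, Int.cast_one, mul_one] at hγz
  have he : (2 * Real.pi * Complex.I)⁻¹ ≠ 0 := inv_ne_zero Complex.two_pi_I_ne_zero
  have hjw := zpow_ne_zero w hj
  generalize (2 * Real.pi * Complex.I)⁻¹ = e at *
  generalize denom γ z = j at *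
  generalize j ^ w = t at *
  norm_cast at hγz
  have hfactor : t * (24 * e * (6 * e * C z - j * (B z - E2 z * C z))) = 0 := by
    field_simp at hγz
    linear_combination hγz - t * j ^ 2 * hz
  simpa [hjw, he, sub_eq_zero] using hfactor

lemma eq_zero_of_combination_eq_zero (hA : IsModular w A) (hB : IsModular (w - 2) B)
    (hC : IsModular (w - 4) C) (h : ∀ z, A z - 2 * E2 z * B z + E2 z ^ 2 * C z = 0) (z : ℍ) :
    A z = 0 ∧ B z = 0 ∧ C z = 0 := by
  have hS := mul_eq_denom_mul_of_combination_eq_zero hA hB hC h (γ := ModularGroup.S) rfl z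
  have hST := mul_eq_denom_mul_of_combination_eq_zero hA hB hC h
    (γ := ModularGroup.S * ModularGroup.T) (by decide) z
  have hdenom : denom (ModularGroup.S * ModularGroup.T : SL(2, ℤ)) z = z + 1 := by
    rw [ModularGroup.denom_apply,
      show (ModularGroup.S * ModularGroup.T : SL(2, ℤ)) 1 0 = 1 by decide,
      show (ModularGroup.S * ModularGroup.T : SL(2, ℤ)) 1 1 = 1 by decide]
    simp
  rw [ModularGroup.denom_S] at hS
  rw [hdenom] at hST
  -- The left-hand sides of `hS` and `hST` agree, while the factors `z` and `z + 1` differ.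
  have hG : B z - E2 z * C z = 0 := by linear_combination hS - hST
  have hCz : C z = 0 := by
    rw [hG, mul_zero] at hS
    exact (mul_eq_zero.mp hS).resolve_left
      (mul_ne_zero (by norm_num) (inv_ne_zero Complex.two_pi_I_ne_zero))
  have hBz : B z = 0 := by simpa [hCz] using hG
  exact ⟨by simpa [hBz, hCz] using h z, hBz, hCz⟩

end Uniqueness

lemma IsDecomposition.unique {w : ℤ} {F : ℍ → ℂ} {A A' : ModularForm 𝒮ℒ w}
    {B B' : ModularForm 𝒮ℒ (w - 2)} {C C' : ModularForm 𝒮ℒ (w - 4)}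
    (h : IsDecomposition w F A B C) (h' : IsDecomposition w F A' B' C') :
    A = A' ∧ B = B' ∧ C = C' := by
  have hdiff := eq_zero_of_combination_eq_zero (IsModular.sub ⟨A, rfl⟩ ⟨A', rfl⟩)
    (IsModular.sub ⟨B, rfl⟩ ⟨B', rfl⟩) (IsModular.sub ⟨C, rfl⟩ ⟨C', rfl⟩)
    (fun z => by linear_combination h' z - h z)
  exact ⟨ModularForm.ext fun z => sub_eq_zero.mp (hdiff z).1,
    ModularForm.ext fun z => sub_eq_zero.mp (hdiff z).2.1,
    ModularForm.ext fun z => sub_eq_zero.mp (hdiff z).2.2⟩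

lemma IsQuasimodularTriple.exists_isDecomposition {w : ℤ} {F G H : ℍ → ℂ}
    (h : IsQuasimodularTriple w F G H) : ∃ A B C, IsDecomposition w F A B C ∧
      (∀ z, B z - E2 z * C z = G z) ∧ ∀ z, C z = H z := by
  obtain ⟨⟨A, hA⟩, ⟨B, hB⟩, ⟨C, hC⟩⟩ := h
  simp only [funext_iff] at hA hB hC
  refine ⟨A, B, C, fun z => ?_, fun z => ?_, hC⟩
  · rw [hA, hB, hC]
    ring
  · rw [hB, hC]
    ring

theorem IsRecurrenceSequence.exists_isDecomposition {f : ℕ → ℍ → ℂ}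
    (hf : IsRecurrenceSequence f) (k : ℕ) :
    ∃ A B C, IsDecomposition (4 * k + 10 : ℕ) (f (4 * k + 10)) A B C ∧
      HasExactOrder (fun z => B z - E2 z * C z) 1 ∧ HasExactOrder C 0 := by
  obtain ⟨G, H, h, ⟨γ, hγ₀, hγ⟩, χ, hχ₀, hχ⟩ := hf.exists_isQuasimodularTriple k
  obtain ⟨A, B, C, hABC, hG, hH⟩ :=
    (h.congr (v := (4 * k + 10 : ℕ)) (fun _ => rfl) (by push_cast; rfl)).exists_isDecomposition
  exact ⟨A, B, C, hABC, (hγ.congr hG rfl).hasExactOrder hγ₀, (hχ.congr hH rfl).hasExactOrder hχ₀⟩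

end QuasimodularRecurrence

theorem proposition5p3 (f : ℕ → ℍ → ℂ)
    (hf : QuasimodularRecurrence.IsRecurrenceSequence f) :
    -- the initial elements in terms of second derivatives
    (∀ z : ℍ, f 10 z = -(24 / 7) * (D^[2] E₆) z) ∧
    (∀ z : ℍ, f 14 z = -(3 / 19250) * (D^[2] (fun τ => E₄ τ * E₆ τ)) z
      - 36 / 875 * (E2 z * discriminant z)) ∧
    (∀ z : ℍ, f 18 z = -(1 / 242550000) * (D^[2] (fun τ => E₄ τ ^ 2 * E₆ τ)) z
      + discriminant z * (181 * E₆ z - 185 * (E2 z * E₄ z)) / 40425000) ∧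
    ∀ w : ℕ, 10 ≤ w → w % 4 = 2 →
      -- the differential equation
      QuasimodularRecurrence.SolvesODE w (f w) ∧
      -- quasimodularity of weight `w`, and uniqueness of the components
      (∃! p : ModularForm 𝒮ℒ (w : ℤ) × ModularForm 𝒮ℒ ((w : ℤ) - 2) × ModularForm 𝒮ℒ ((w : ℤ) - 4),
        QuasimodularRecurrence.IsDecomposition w (f w) p.1 p.2.1 p.2.2) ∧
      -- the exact orders of `f w`, `g w = B - E₂ C` and `h w = C`
      QuasimodularRecurrence.HasExactOrder (f w) ((w - 6) / 4) ∧
      ∀ (A : ModularForm 𝒮ℒ (w : ℤ)) (B : ModularForm 𝒮ℒ ((w : ℤ) - 2))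
        (C : ModularForm 𝒮ℒ ((w : ℤ) - 4)),
        QuasimodularRecurrence.IsDecomposition w (f w) A B C →
          QuasimodularRecurrence.HasExactOrder (fun z => B z - E2 z * C z) 1 ∧
          QuasimodularRecurrence.HasExactOrder C 0 := by
  refine ⟨hf.init_ten_eq_deriv, hf.init_fourteen_eq_deriv, hf.init_eighteen_eq_deriv,
    fun w hw hw4 => ?_⟩
  obtain ⟨k, rfl⟩ : ∃ k, w = 4 * k + 10 := ⟨(w - 10) / 4, by omega⟩
  obtain ⟨A, B, C, h, hG, hC⟩ := hf.exists_isDecomposition k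
  obtain ⟨φ, hφ₀, hφ⟩ := hf.exists_hasLeadingTerm_ne_zero k
  refine ⟨?_, ⟨(A, B, C), h, fun p hp => ?_⟩, ?_, fun A' B' C' h' => ?_⟩
  · exact_mod_cast hf.solvesODE k
  · obtain ⟨hA, hB, hC⟩ := hp.unique h
    exact Prod.ext hA (Prod.ext hB hC)
  · rw [show (4 * k + 10 - 6) / 4 = k + 1 by omega]
    exact hφ.hasExactOrder hφ₀
  · obtain ⟨rfl, rfl, rfl⟩ := h.unique h'
    exact ⟨hG, hC⟩
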